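/- **Theorem 4.1.** Let $A,A_d\in\mathbb{R}^{n\times n}$, let $1\le h_1\le h_2$ be integers, and consider the discrete-time system with interval time-varying delay $$x(k+1)=Ax(k)+A_dx(k-h(k)),\quad k\ge 0,\qquad x(k)=\phi(k),\quad k\in\{-h_2,\dots,0\},\tag{1}$$ with integer delays $h_1\le h(k)\le h_2$. Put $h_{12}=h_2-h_1$, $T(h)=h+1$, $\gamma(h)=\tfrac12 T(h)T(h+1)$, $\mathrm{He}(M)=M+M^T$. Put $c_1=c_2=c_3=1$ if $h_1=1$, and, if $h_1>1$, $$c_1=\frac{h_1+1}{h_1-1},\qquad c_2=\frac{(h_1+1)(h_1+2)^2}{(h_1-1)(h_1^2+11)},\qquad c_3=\frac{h_1+2}{h_1-1}.$$ Let $e_1,\dots,e_{10}\in\mathbb{R}^{n\times 10n}$ be the consecutive block rows of the identity matrix $I_{10n}$, let $\mathcal{A}=(A-I_n)e_1+A_de_3$, and let $\mathrm{col}$ and $\mathrm{diag}$ denote vertical stacking and block-diagonal matrices. Set $$\begin{aligned} \Omega(h)&=\mathrm{col}\{e_1,\;T(h_1)e_5,\;T(h-h_1)e_6+T(h_2-h)e_7,\;\gamma(h_1)e_8\},\\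 \Omega_1&=\mathrm{col}\{-\mathcal{A},\;e_2,\;e_3+e_4,\;T(h_1)e_5\},\qquad \Omega_2=\mathrm{col}\{0,\;e_1,\;e_2+e_3,\;T(h_1)e_1\},\\ \Gamma_1&=\mathrm{col}\{e_1-e_2,\;e_1+e_2-2e_5,\;e_1-e_2+6e_5-6e_8\},\\ \Gamma_2&=\mathrm{col}\{e_2-e_3,\;e_2+e_3-2e_6,\;e_2-e_3+6e_6-6e_9\},\\ \Gamma_3&=\mathrm{col}\{e_3-e_4,\;e_3+e_4-2e_7,\;e_3-e_4+6e_7-6e_{10}\},\\ \Gamma_4&=\mathrm{col}\{e_2-e_5,\;e_2-4e_5+3e_8\},\qquad \Gamma_5=\mathrm{col}\{e_3-e_6,\;e_4-e_7\},\\ \Gamma_6&=\mathrm{col}\{e_3-4e_6+3e_9,\;e_4-4e_7+3e_{10}\}. \end{aligned}$$ For real symmetric matrices $P$ of size $4n\times4n$ and $Q_i,R_i,S_i$ $(i=1,2)$ of size $n\times n$, and a real matrix $X$ of size $3n\times 3n$, set $$\begin{aligned} &\tilde R_1=\mathrm{diag}\{R_1,3c_1R_1,5c_2R_1\},\quad \tilde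 R_2=\mathrm{diag}\{R_2,3R_2,5R_2\},\quad \hat S_1=\mathrm{diag}\{S_1,2c_3S_1\},\quad \hat S_2=\mathrm{diag}\{S_2,S_2\},\\ &\Pi_0(h)=\mathrm{He}\big(\Omega(h)^TP(\Omega_2-\Omega_1)\big)+\Omega_1^TP\Omega_1-\Omega_2^TP\Omega_2,\\ &\Pi_1=e_1^TQ_1e_1-e_2^TQ_1e_2+e_2^TQ_2e_2-e_4^TQ_2e_4,\\ &\Pi_2=\mathcal{A}^T\big[h_1^2R_1+h_{12}^2R_2+\gamma(h_1-1)S_1+\gamma(h_{12}-1)S_2\big]\mathcal{A},\\ &\Pi_3=\Gamma_1^T\tilde R_1\Gamma_1,\qquad \Pi_4=\begin{bmatrix}\Gamma_2\\\Gamma_3\end{bmatrix}^T\begin{bmatrix}\tilde R_2&X\\X^T&\tilde R_2\end{bmatrix}\begin{bmatrix}\Gamma_2\\\Gamma_3\end{bmatrix},\\ &\Pi_5=\frac{2(h_1+1)}{h_1}\Gamma_4^T\hat S_1\Gamma_4,\qquad \Pi_6=2\Gamma_5^T\hat S_2\Gamma_5+4\Gamma_6^T\hat S_2\Gamma_6,\\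 &\Pi(h)=\Pi_0(h)+\Pi_1+\Pi_2-\Pi_3-\Pi_4-\Pi_5-\Pi_6 . \end{aligned}$$ Suppose that there are symmetric positive definite matrices $P\in\mathbb{R}^{4n\times 4n}$ and $Q_i,R_i,S_i\in\mathbb{R}^{n\times n}$, $i=1,2$, and a matrix $X\in\mathbb{R}^{3n\times 3n}$ such that $$\begin{bmatrix}\tilde R_2&X\\X^T&\tilde R_2\end{bmatrix}\ge 0,\qquad \Pi(h_1)<0,\qquad \Pi(h_2)<0 .$$ Then, for every delay function $h$ on $\{0,1,2,\dots\}$ with integer values in $[h_1,h_2]$, system (1) is asymptotically stable: for each $\varepsilon>0$ there is $\delta>0$ such that every solution with $\|\phi(s)\|<\delta$ for all $s\in\{-h_2,\dots,0\}$ satisfies $\|x(k)\|<\varepsilon$ for all $k\ge0$, and every solution satisfies $x(k)\to0$ as $k\to\infty$. -/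

import Mathlib

open Matrix Filter Topology

noncomputable section

namespace DelayLMI

/-! ### The system and asymptotic stability -/

/-- `x` is a solution of `x(k+1) = A x(k) + A_d x(k - h(k))` for `k ≥ 0`, with initial condition
`x(k) = φ(k)` for `k ∈ [-h₂, 0]`. The values of `φ` and `x` outside these ranges play no role. -/
def IsSolution {n : ℕ} (A Ad : Matrix (Fin n) (Fin n) ℝ) (h₂ : ℕ) (h : ℕ → ℕ)
    (φ x : ℤ → EuclideanSpace ℝ (Fin n)) : Prop :=
  (∀ k : ℤ, -(h₂ : ℤ) ≤ k → k ≤ 0 → x k = φ k) ∧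
  ∀ k : ℕ, x ((k : ℤ) + 1) =
    Matrix.toEuclideanLin A (x k) + Matrix.toEuclideanLin Ad (x ((k : ℤ) - h k))

/-- (Lyapunov) stability of the zero solution, for the delay function `h`. -/
def IsStable {n : ℕ} (A Ad : Matrix (Fin n) (Fin n) ℝ) (h₂ : ℕ) (h : ℕ → ℕ) : Prop :=
  ∀ ε : ℝ, 0 < ε → ∃ δ : ℝ, 0 < δ ∧ ∀ φ x : ℤ → EuclideanSpace ℝ (Fin n),
    IsSolution A Ad h₂ h φ x →
    (∀ s : ℤ, -(h₂ : ℤ) ≤ s → s ≤ 0 → ‖φ s‖ < δ) → ∀ k : ℕ, ‖x k‖ < ε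

/-- Every solution tends to zero. -/
def IsAttractive {n : ℕ} (A Ad : Matrix (Fin n) (Fin n) ℝ) (h₂ : ℕ) (h : ℕ → ℕ) : Prop :=
  ∀ φ x : ℤ → EuclideanSpace ℝ (Fin n), IsSolution A Ad h₂ h φ x →
    Tendsto (fun k : ℕ => x k) atTop (𝓝 0)

/-- Asymptotic stability: the zero solution is stable and attracts every solution. -/
def IsAsymptoticallyStable {n : ℕ} (A Ad : Matrix (Fin n) (Fin n) ℝ) (h₂ : ℕ) (h : ℕ → ℕ) :
    Prop :=
  IsStable A Ad h₂ h ∧ IsAttractive A Ad h₂ h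

/-! ### Block notation

A vector made of `m` blocks of size `n` is indexed by `Fin n × Fin m`: the index `(a, i)` is the
`a`-th entry of the `i`-th block. -/

/-- A square matrix `M` is negative definite if `vᵀ M v < 0` for all `v ≠ 0`. -/
def IsNegDef {ι : Type*} [Fintype ι] (M : Matrix ι ι ℝ) : Prop :=
  ∀ v : ι → ℝ, v ≠ 0 → v ⬝ᵥ (M *ᵥ v) < 0

/-- `He(M) = M + Mᵀ`. -/
def He {ι : Type*} (M : Matrix ι ι ℝ) : Matrix ι ι ℝ := M + Mᵀ

/-- Block rows: `n × 10n` matrices. -/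
abbrev Row (n : ℕ) : Type := Matrix (Fin n) (Fin n × Fin 10) ℝ

/-- The `i`-th block row `e_i = e_i^* ⊗ I_n` of the identity of size `10n`, for `i = 1, …, 10`
(counted from `1`; the matrix is zero for other `i`). -/
def e (n : ℕ) (i : ℕ) : Row n :=
  Matrix.of fun a p => if (p.2 : ℕ) + 1 = i ∧ p.1 = a then 1 else 0

/-- `col{B₀, …, B_{m-1}}`: block rows stacked on top of each other. -/
def col {n m : ℕ} (B : Fin m → Row n) : Matrix (Fin n × Fin m) (Fin n × Fin 10) ℝ :=
  Matrix.of fun p q => B p.2 p.1 q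

/-! ### The scalars -/

/-- `T(h) = h + 1`. -/
def T (h : ℝ) : ℝ := h + 1

/-- `γ(h) = T(h) T(h+1) / 2`. -/
def γ (h : ℝ) : ℝ := T h * T (h + 1) / 2

def c₁ (h₁ : ℝ) : ℝ := if h₁ = 1 then 1 else (h₁ + 1) / (h₁ - 1)

def c₂ (h₁ : ℝ) : ℝ :=
  if h₁ = 1 then 1 else (h₁ + 1) * (h₁ + 2) ^ 2 / ((h₁ - 1) * (h₁ ^ 2 + 11))

def c₃ (h₁ : ℝ) : ℝ := if h₁ = 1 then 1 else (h₁ + 2) / (h₁ - 1)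

/-! ### The block matrices -/

/-- `𝒜 = (A - I) e₁ + A_d e₃`. -/
def calA {n : ℕ} (A Ad : Matrix (Fin n) (Fin n) ℝ) : Row n := (A - 1) * e n 1 + Ad * e n 3

def Ω (n : ℕ) (h₁ h₂ h : ℝ) : Matrix (Fin n × Fin 4) (Fin n × Fin 10) ℝ :=
  col ![e n 1, T h₁ • e n 5, T (h - h₁) • e n 6 + T (h₂ - h) • e n 7, γ h₁ • e n 8]

def Ω₁ {n : ℕ} (A Ad : Matrix (Fin n) (Fin n) ℝ) (h₁ : ℝ) : Matrix (Fin n × Fin 4) (Fin n × Fin 10) ℝ :=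
  col ![-calA A Ad, e n 2, e n 3 + e n 4, T h₁ • e n 5]

def Ω₂ (n : ℕ) (h₁ : ℝ) : Matrix (Fin n × Fin 4) (Fin n × Fin 10) ℝ :=
  col ![0, e n 1, e n 2 + e n 3, T h₁ • e n 1]

def Γ₁ (n : ℕ) : Matrix (Fin n × Fin 3) (Fin n × Fin 10) ℝ :=
  col ![e n 1 - e n 2, e n 1 + e n 2 - (2 : ℝ) • e n 5, e n 1 - e n 2 + (6 : ℝ) • e n 5 - (6 : ℝ) • e n 8]

def Γ₂ (n : ℕ) : Matrix (Fin n × Fin 3) (Fin n × Fin 10) ℝ :=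
  col ![e n 2 - e n 3, e n 2 + e n 3 - (2 : ℝ) • e n 6, e n 2 - e n 3 + (6 : ℝ) • e n 6 - (6 : ℝ) • e n 9]

def Γ₃ (n : ℕ) : Matrix (Fin n × Fin 3) (Fin n × Fin 10) ℝ :=
  col ![e n 3 - e n 4, e n 3 + e n 4 - (2 : ℝ) • e n 7, e n 3 - e n 4 + (6 : ℝ) • e n 7 - (6 : ℝ) • e n 10]

def Γ₄ (n : ℕ) : Matrix (Fin n × Fin 2) (Fin n × Fin 10) ℝ :=
  col ![e n 2 - e n 5, e n 2 - (4 : ℝ) • e n 5 + (3 : ℝ) • e n 8]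

def Γ₅ (n : ℕ) : Matrix (Fin n × Fin 2) (Fin n × Fin 10) ℝ :=
  col ![e n 3 - e n 6, e n 4 - e n 7]

def Γ₆ (n : ℕ) : Matrix (Fin n × Fin 2) (Fin n × Fin 10) ℝ :=
  col ![e n 3 - (4 : ℝ) • e n 6 + (3 : ℝ) • e n 9, e n 4 - (4 : ℝ) • e n 7 + (3 : ℝ) • e n 10]

/-- `R̃₁(h₁) = diag{R₁, 3c₁(h₁)R₁, 5c₂(h₁)R₁}`. -/
def Rt₁ {n : ℕ} (R₁ : Matrix (Fin n) (Fin n) ℝ) (h₁ : ℝ) : Matrix (Fin n × Fin 3) (Fin n × Fin 3) ℝ :=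
  blockDiagonal ![R₁, (3 * c₁ h₁) • R₁, (5 * c₂ h₁) • R₁]

/-- `R̃₂ = diag{R₂, 3R₂, 5R₂}`. -/
def Rt₂ {n : ℕ} (R₂ : Matrix (Fin n) (Fin n) ℝ) : Matrix (Fin n × Fin 3) (Fin n × Fin 3) ℝ :=
  blockDiagonal ![R₂, (3 : ℝ) • R₂, (5 : ℝ) • R₂]

/-- `Ŝ₁(h₁) = diag{S₁, 2c₃(h₁)S₁}`. -/
def Sh₁ {n : ℕ} (S₁ : Matrix (Fin n) (Fin n) ℝ) (h₁ : ℝ) : Matrix (Fin n × Fin 2) (Fin n × Fin 2) ℝ :=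
  blockDiagonal ![S₁, (2 * c₃ h₁) • S₁]

/-- `Ŝ₂ = diag{S₂, S₂}`. -/
def Sh₂ {n : ℕ} (S₂ : Matrix (Fin n) (Fin n) ℝ) : Matrix (Fin n × Fin 2) (Fin n × Fin 2) ℝ :=
  blockDiagonal ![S₂, S₂]

/-- The block matrix `[R̃₂ X; Xᵀ R̃₂]`. -/
def couplingMatrix {n : ℕ} (R₂ : Matrix (Fin n) (Fin n) ℝ) (X : Matrix (Fin n × Fin 3) (Fin n × Fin 3) ℝ) :
    Matrix ((Fin n × Fin 3) ⊕ (Fin n × Fin 3)) ((Fin n × Fin 3) ⊕ (Fin n × Fin 3)) ℝ :=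
  fromBlocks (Rt₂ R₂) X Xᵀ (Rt₂ R₂)

/-! ### The matrices `Π₀(h), Π₁, …, Π₆` and `Π(h)` -/

def Pi₀ {n : ℕ} (A Ad : Matrix (Fin n) (Fin n) ℝ) (P : Matrix (Fin n × Fin 4) (Fin n × Fin 4) ℝ)
    (h₁ h₂ h : ℝ) : Matrix (Fin n × Fin 10) (Fin n × Fin 10) ℝ :=
  He ((Ω n h₁ h₂ h)ᵀ * P * (Ω₂ n h₁ - Ω₁ A Ad h₁))
    + (Ω₁ A Ad h₁)ᵀ * P * Ω₁ A Ad h₁ - (Ω₂ n h₁)ᵀ * P * Ω₂ n h₁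

def Pi₁ {n : ℕ} (Q₁ Q₂ : Matrix (Fin n) (Fin n) ℝ) : Matrix (Fin n × Fin 10) (Fin n × Fin 10) ℝ :=
  (e n 1)ᵀ * Q₁ * e n 1 - (e n 2)ᵀ * Q₁ * e n 2 + (e n 2)ᵀ * Q₂ * e n 2 - (e n 4)ᵀ * Q₂ * e n 4

/-- Here `h₁₂ = h₂ - h₁`. -/
def Pi₂ {n : ℕ} (A Ad R₁ R₂ S₁ S₂ : Matrix (Fin n) (Fin n) ℝ) (h₁ h₂ : ℝ) :
    Matrix (Fin n × Fin 10) (Fin n × Fin 10) ℝ :=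
  (calA A Ad)ᵀ * (h₁ ^ 2 • R₁ + (h₂ - h₁) ^ 2 • R₂ + γ (h₁ - 1) • S₁ + γ (h₂ - h₁ - 1) • S₂)
    * calA A Ad

def Pi₃ {n : ℕ} (R₁ : Matrix (Fin n) (Fin n) ℝ) (h₁ : ℝ) : Matrix (Fin n × Fin 10) (Fin n × Fin 10) ℝ :=
  (Γ₁ n)ᵀ * Rt₁ R₁ h₁ * Γ₁ n

def Pi₄ {n : ℕ} (R₂ : Matrix (Fin n) (Fin n) ℝ) (X : Matrix (Fin n × Fin 3) (Fin n × Fin 3) ℝ) :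
    Matrix (Fin n × Fin 10) (Fin n × Fin 10) ℝ :=
  (fromRows (Γ₂ n) (Γ₃ n))ᵀ * couplingMatrix R₂ X * fromRows (Γ₂ n) (Γ₃ n)

def Pi₅ {n : ℕ} (S₁ : Matrix (Fin n) (Fin n) ℝ) (h₁ : ℝ) : Matrix (Fin n × Fin 10) (Fin n × Fin 10) ℝ :=
  (2 * (h₁ + 1) / h₁) • ((Γ₄ n)ᵀ * Sh₁ S₁ h₁ * Γ₄ n)

def Pi₆ {n : ℕ} (S₂ : Matrix (Fin n) (Fin n) ℝ) : Matrix (Fin n × Fin 10) (Fin n × Fin 10) ℝ :=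
  (2 : ℝ) • ((Γ₅ n)ᵀ * Sh₂ S₂ * Γ₅ n) + (4 : ℝ) • ((Γ₆ n)ᵀ * Sh₂ S₂ * Γ₆ n)

/-- `Π(h) = Π₀(h) + (Π₁ + Π₂) - (Π₃ + Π₄ + Π₅ + Π₆)`. -/
def PiMatrix {n : ℕ} (A Ad : Matrix (Fin n) (Fin n) ℝ) (P : Matrix (Fin n × Fin 4) (Fin n × Fin 4) ℝ)
    (Q₁ Q₂ R₁ R₂ S₁ S₂ : Matrix (Fin n) (Fin n) ℝ)
    (X : Matrix (Fin n × Fin 3) (Fin n × Fin 3) ℝ) (h₁ h₂ h : ℝ) :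
    Matrix (Fin n × Fin 10) (Fin n × Fin 10) ℝ :=
  Pi₀ A Ad P h₁ h₂ h + (Pi₁ Q₁ Q₂ + Pi₂ A Ad R₁ R₂ S₁ S₂ h₁ h₂)
    - (Pi₃ R₁ h₁ + Pi₄ R₂ X + Pi₅ S₁ h₁ + Pi₆ S₂)

end DelayLMI

end

/-!
The theorem is proved with a Lyapunov functional. At time `k` let `V k` be the sum of a quadratic
form `P` in an augmented state (the current state, two sums and a double sum of past states), of
sums of the forms `Q₁`, `Q₂` over past states, and of weighted double sums of the forms `R₁`, `R₂`,
`S₁`, `S₂` over past increments `Δx`. With `ζ` the vector of ten states and averages of states that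
the blocks `e₁, …, e₁₀` select, the increment `V (k+1) - V k` is exactly
`ζᵀ (Π₀(h) + Π₁ + Π₂) ζ` minus sums of `Δxᵀ R Δx` and `Δxᵀ S Δx` over the delay windows.

Those sums are bounded below by `ζᵀ (Π₃ + Π₄ + Π₅ + Π₆) ζ`. Each bound is Bessel's inequality
(`bessel_three`) for discrete orthogonal polynomials: up to scaling and after summation by parts,
`Γ₁, Γ₂, Γ₃` are the coefficients of `Δx` along the discrete Legendre polynomials of degree
`0, 1, 2` (`wirtinger`), and `Γ₄, Γ₅, Γ₆` those along the orthogonal polynomials of degree `0, 1`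
for a linearly decreasing weight (`double_sum`). On the window `[k - h₂, k - h₁]`, which `k - h(k)`
cuts in two, the bounds for the two pieces are combined by the reciprocally convex inequality
`coupling_le`; this is where `[R̃₂ X; Xᵀ R̃₂] ≥ 0` enters.
Altogether `V (k+1) - V k ≤ ζᵀ Π(h(k)) ζ` (`lyapunov_succ_sub_le`).

`Π(h)` is affine in `h`, so negative definiteness at `h₁` and `h₂` gives a uniform bound
`V (k+1) - V k ≤ -μ ‖x(k)‖²` (`exists_quad_PiMatrix_le`). As `V k ≥ ν ‖x(k)‖²`, and `V 0` is a
continuous function of the initial history vanishing at zero, the zero solution is stable;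
summing the decrease shows that `∑ ‖x(k)‖²` converges, so `x(k) → 0`.
-/

open Matrix Filter Topology

noncomputable section

namespace DelayLMI

/-! ### Scalar summation inequalities -/

/-- A weighted Bessel inequality for three mutually orthogonal functions `p`, `q`, `r` on
`{0, …, N-1}`. Only upper bounds for the norms of `p`, `q`, `r` are required, so that functions
which vanish identically (as discrete Legendre polynomials on few points do) are allowed, with
any coefficient. -/
lemma bessel_three {N : ℕ} {w p q r : ℕ → ℝ} {K a b c : ℝ} (y : ℕ → ℝ)
    (hw : ∀ i < N, 0 ≤ w i) (hK : 0 < K) (ha : 0 ≤ a) (hb : 0 ≤ b) (hc : 0 ≤ c)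
    (hpq : ∑ i ∈ Finset.range N, w i * (p i * q i) = 0)
    (hpr : ∑ i ∈ Finset.range N, w i * (p i * r i) = 0)
    (hqr : ∑ i ∈ Finset.range N, w i * (q i * r i) = 0)
    (hp : a * ∑ i ∈ Finset.range N, w i * p i ^ 2 ≤ K)
    (hq : b * ∑ i ∈ Finset.range N, w i * q i ^ 2 ≤ K)
    (hr : c * ∑ i ∈ Finset.range N, w i * r i ^ 2 ≤ K) :
    a * (∑ i ∈ Finset.range N, w i * (p i * y i)) ^ 2
      + b * (∑ i ∈ Finset.range N, w i * (q i * y i)) ^ 2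
      + c * (∑ i ∈ Finset.range N, w i * (r i * y i)) ^ 2
      ≤ K * ∑ i ∈ Finset.range N, w i * y i ^ 2 := by
  set s := ∑ i ∈ Finset.range N, w i * (p i * y i) with hs
  set t := ∑ i ∈ Finset.range N, w i * (q i * y i) with ht
  set u := ∑ i ∈ Finset.range N, w i * (r i * y i) with hu
  have hnonneg : 0 ≤ ∑ i ∈ Finset.range N,
      w i * (K * y i - a * s * p i - b * t * q i - c * u * r i) ^ 2 :=
    Finset.sum_nonneg fun i hi => mul_nonneg (hw i (Finset.mem_range.1 hi)) (sq_nonneg _)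
  have hexpand : ∀ α β δ : ℝ, ∑ i ∈ Finset.range N,
      w i * (K * y i - α * p i - β * q i - δ * r i) ^ 2
      = K ^ 2 * ∑ i ∈ Finset.range N, w i * y i ^ 2
        + α ^ 2 * ∑ i ∈ Finset.range N, w i * p i ^ 2
        + β ^ 2 * ∑ i ∈ Finset.range N, w i * q i ^ 2
        + δ ^ 2 * ∑ i ∈ Finset.range N, w i * r i ^ 2
        + -2 * K * α * s + -2 * K * β * t + -2 * K * δ * u
        + 2 * α * β * ∑ i ∈ Finset.range N, w i * (p i * q i)
        + 2 * α * δ * ∑ i ∈ Finset.range N, w i * (p i * r i)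
        + 2 * β * δ * ∑ i ∈ Finset.range N, w i * (q i * r i) := by
    intro α β δ
    simp only [hs, ht, hu, Finset.mul_sum, ← Finset.sum_add_distrib]
    exact Finset.sum_congr rfl fun i _ => by ring
  rw [hexpand, hpq, hpr, hqr] at hnonneg
  have h1 := mul_le_mul_of_nonneg_left hp (mul_nonneg ha (sq_nonneg s))
  have h2 := mul_le_mul_of_nonneg_left hq (mul_nonneg hb (sq_nonneg t))
  have h3 := mul_le_mul_of_nonneg_left hr (mul_nonneg hc (sq_nonneg u))
  refine le_of_mul_le_mul_left ?_ hK
  linarith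

lemma sum_range_quartic (N : ℕ) (a b c d e : ℝ) :
    ∑ i ∈ Finset.range N, (a + b * i + c * (i : ℝ) ^ 2 + d * (i : ℝ) ^ 3 + e * (i : ℝ) ^ 4)
      = a * N + b * (N * (N - 1) / 2) + c * (N * (N - 1) * (2 * N - 1) / 6)
        + d * (N * (N - 1) / 2) ^ 2
        + e * (N * (N - 1) * (2 * N - 1) * (3 * (N : ℝ) ^ 2 - 3 * N - 1) / 30) := by
  induction N with
  | zero => simp
  | succ N ih => rw [Finset.sum_range_succ, ih]; push_cast; ring

/-- If a summand is a quartic polynomial in the index, its sum is given by Faulhaber's formulas. -/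
lemma sum_range_eq_of_quartic {N : ℕ} {f : ℕ → ℝ} {S : ℝ} (a b c d e : ℝ)
    (hf : ∀ i, f i = a + b * i + c * (i : ℝ) ^ 2 + d * (i : ℝ) ^ 3 + e * (i : ℝ) ^ 4)
    (hS : a * N + b * (N * (N - 1) / 2) + c * (N * (N - 1) * (2 * N - 1) / 6)
        + d * (N * (N - 1) / 2) ^ 2
        + e * (N * (N - 1) * (2 * N - 1) * (3 * (N : ℝ) ^ 2 - 3 * N - 1) / 30) = S) :
    ∑ i ∈ Finset.range N, f i = S := by
  rw [← hS, ← sum_range_quartic]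
  exact Finset.sum_congr rfl fun i _ => hf i

lemma sum_range_succ_mul_sub (N : ℕ) (x : ℕ → ℝ) :
    ∑ i ∈ Finset.range N, ((i : ℝ) + 1) * (x (i + 1) - x i)
      = (N + 1) * x N - ∑ j ∈ Finset.range (N + 1), x j := by
  induction N with
  | zero => simp
  | succ N ih => rw [Finset.sum_range_succ, ih, Finset.sum_range_succ _ (N + 1)]; push_cast; ring

lemma sum_range_succ_mul_succ_mul_sub (N : ℕ) (x : ℕ → ℝ) :
    ∑ i ∈ Finset.range N, ((i : ℝ) + 1) * (i + 2) * (x (i + 1) - x i)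
      = (N + 1) * (N + 2) * x N - 2 * ∑ j ∈ Finset.range (N + 1), ((j : ℝ) + 1) * x j := by
  induction N with
  | zero => simp
  | succ N ih => rw [Finset.sum_range_succ, ih, Finset.sum_range_succ _ (N + 1)]; push_cast; ring

/-- Summation by parts against a quadratic polynomial, written in the basis `1`, `i + 1`,
`(i + 1)(i + 2)`. -/
lemma sum_range_quadratic_mul_sub {N : ℕ} {x f : ℕ → ℝ} (a b c : ℝ)
    (hf : ∀ i, f i = (a + b * (i + 1) + c * ((i + 1) * (i + 2))) * (x (i + 1) - x i)) :
    ∑ i ∈ Finset.range N, f i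
      = a * (x N - x 0) + b * ((N + 1) * x N - ∑ j ∈ Finset.range (N + 1), x j)
        + c * ((N + 1) * (N + 2) * x N
          - 2 * ∑ j ∈ Finset.range (N + 1), ((j : ℝ) + 1) * x j) := by
  rw [← Finset.sum_range_sub, ← sum_range_succ_mul_sub, ← sum_range_succ_mul_succ_mul_sub]
  simp only [Finset.mul_sum, ← Finset.sum_add_distrib]
  exact Finset.sum_congr rfl fun i _ => by rw [hf]; ring

lemma one_le_c₁ {N : ℕ} (hN : 1 ≤ N) : 1 ≤ c₁ N := by
  have hN' : (1 : ℝ) ≤ N := by exact_mod_cast hN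
  unfold c₁
  split_ifs with h
  · exact le_rfl
  · rw [le_div_iff₀ (sub_pos.2 (lt_of_le_of_ne hN' (Ne.symm h)))]; linarith

lemma one_le_c₂ {N : ℕ} (hN : 1 ≤ N) : 1 ≤ c₂ N := by
  have hN' : (1 : ℝ) ≤ N := by exact_mod_cast hN
  unfold c₂
  split_ifs with h
  · exact le_rfl
  · have : (0 : ℝ) < N - 1 := sub_pos.2 (lt_of_le_of_ne hN' (Ne.symm h))
    rw [le_div_iff₀ (by positivity)]
    nlinarith [sq_nonneg (N : ℝ)]

lemma one_le_c₃ {N : ℕ} (hN : 1 ≤ N) : 1 ≤ c₃ N := by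
  have hN' : (1 : ℝ) ≤ N := by exact_mod_cast hN
  unfold c₃
  split_ifs with h
  · exact le_rfl
  · rw [le_div_iff₀ (sub_pos.2 (lt_of_le_of_ne hN' (Ne.symm h)))]; linarith

lemma c₁_mul_sub_one_le {N : ℕ} (hN : 1 ≤ N) : c₁ N * (N - 1) ≤ N + 1 := by
  have hN' : (1 : ℝ) ≤ N := by exact_mod_cast hN
  unfold c₁
  split_ifs with h
  · linarith
  · rw [div_mul_cancel₀ _ (sub_ne_zero.2 h)]

lemma c₂_mul_le {N : ℕ} (hN : 1 ≤ N) :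
    c₂ N * ((N - 1) * (N - 2)) ≤ ((N : ℝ) + 1) * (N + 2) := by
  have hN' : (1 : ℝ) ≤ N := by exact_mod_cast hN
  unfold c₂
  split_ifs with h
  · rw [h]; norm_num
  · have h0 : (0 : ℝ) < N - 1 := sub_pos.2 (lt_of_le_of_ne hN' (Ne.symm h))
    have h1 : (0 : ℝ) < (N : ℝ) ^ 2 + 11 := by positivity
    have : ((N : ℝ) + 1) * (N + 2) ^ 2 / ((N - 1) * (N ^ 2 + 11)) * ((N - 1) * (N - 2))
        = (N + 1) * (N + 2) * (((N : ℝ) ^ 2 - 4) / (N ^ 2 + 11)) := by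
      field_simp; ring
    rw [this]
    refine mul_le_of_le_one_right (by positivity) ?_
    rw [div_le_one h1]; linarith

lemma c₃_mul_sub_one_le {N : ℕ} (hN : 1 ≤ N) : c₃ N * (N - 1) ≤ N + 2 := by
  have hN' : (1 : ℝ) ≤ N := by exact_mod_cast hN
  unfold c₃
  split_ifs with h
  · linarith
  · rw [div_mul_cancel₀ _ (sub_ne_zero.2 h)]

/-- The second-order discrete Wirtinger inequality. It is Bessel's inequality for the differences
`x (i+1) - x i` and the discrete Legendre polynomials of degree at most two on `N` points; the
coefficients `c₁` and `c₂` are bounded by the reciprocals of their normalised squared norms. -/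
lemma wirtinger_scalar {N : ℕ} (hN : 1 ≤ N) (x : ℕ → ℝ) :
    (x N - x 0) ^ 2
      + 3 * c₁ N * (x N + x 0 - 2 * ((T N)⁻¹ * ∑ j ∈ Finset.range (N + 1), x j)) ^ 2
      + 5 * c₂ N * (x N - x 0 + 6 * ((T N)⁻¹ * ∑ j ∈ Finset.range (N + 1), x j)
          - 6 * ((γ N)⁻¹ * ∑ j ∈ Finset.range (N + 1), ((j : ℝ) + 1) * x j)) ^ 2
      ≤ N * ∑ i ∈ Finset.range N, (x (i + 1) - x i) ^ 2 := by
  have hN' : (1 : ℝ) ≤ N := by exact_mod_cast hN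
  have hc1 := c₁_mul_sub_one_le hN
  have hc2 := c₂_mul_le hN
  have h1 : 0 ≤ c₁ N := zero_le_one.trans (one_le_c₁ hN)
  have h2 : 0 ≤ c₂ N := zero_le_one.trans (one_le_c₂ hN)
  have key := bessel_three (N := N) (w := fun _ => 1) (p := fun _ => 1)
    (q := fun i => 2 * i + 1 - N) (r := fun i => (N + 1) * (N + 2) - 6 * (i + 1) * (N - i))
    (K := N) (a := 1) (b := 3 * c₁ N / (N + 1) ^ 2) (c := 5 * c₂ N / ((N + 1) * (N + 2)) ^ 2)
    (fun i => x (i + 1) - x i) (fun _ _ => zero_le_one) (by positivity) zero_le_one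
    (by positivity) (by positivity)
    (sum_range_eq_of_quartic (1 - N) 2 0 0 0 (fun i => by ring) (by ring))
    (sum_range_eq_of_quartic ((N + 1) * (N + 2) - 6 * N) (6 - 6 * N) 6 0 0
      (fun i => by ring) (by ring))
    (sum_range_eq_of_quartic ((1 - N) * ((N + 1) * (N + 2) - 6 * N))
      (2 * ((N + 1) * (N + 2) - 6 * N) + (1 - N) * (6 - 6 * N))
      ((1 - N) * 6 + 2 * (6 - 6 * N)) 12 0 (fun i => by ring) (by ring))
    (by simp) ?_ ?_
  · have e0 : ∑ i ∈ Finset.range N, (x (i + 1) - x i) = _ :=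
      sum_range_quadratic_mul_sub (x := x) 1 0 0 fun i => by ring
    have e1 : ∑ i ∈ Finset.range N, ((2 * (i : ℝ) + 1 - N) * (x (i + 1) - x i)) = _ :=
      sum_range_quadratic_mul_sub (x := x) (-1 - N) 2 0 fun i => by ring
    have e2 : ∑ i ∈ Finset.range N, ((((N : ℝ) + 1) * (N + 2) - 6 * (i + 1) * (N - i))
          * (x (i + 1) - x i)) = _ :=
      sum_range_quadratic_mul_sub (x := x)
        ((N + 1) * (N + 2)) (-6 * (N + 2)) 6 fun i => by ring
    simp only [one_mul] at key
    rw [e0, e1, e2] at key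
    refine le_of_eq_of_le ?_ key
    unfold γ T
    field_simp
    ring
  · rw [sum_range_eq_of_quartic (S := N * (N - 1) * (N + 1) / 3) ((1 - N) ^ 2) (4 * (1 - N)) 4 0 0
      (fun i => by ring) (by ring)]
    have : 3 * c₁ N / ((N : ℝ) + 1) ^ 2 * (N * (N - 1) * (N + 1) / 3)
        = N * (c₁ N * (N - 1) / (N + 1)) := by field_simp
    rw [this]
    refine mul_le_of_le_one_right (by positivity) ?_
    rwa [div_le_one (by positivity)]
  · rw [sum_range_eq_of_quartic (S := N * (N - 1) * (N - 2) * (N + 1) * (N + 2) / 5)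
      (((N + 1) * (N + 2) - 6 * N) ^ 2) (2 * ((N + 1) * (N + 2) - 6 * N) * (6 - 6 * N))
      (12 * ((N + 1) * (N + 2) - 6 * N) + (6 - 6 * N) ^ 2) (12 * (6 - 6 * N)) 36
      (fun i => by ring) (by ring)]
    have : 5 * c₂ N / (((N : ℝ) + 1) * (N + 2)) ^ 2
          * (N * (N - 1) * (N - 2) * (N + 1) * (N + 2) / 5)
        = N * (c₂ N * ((N - 1) * (N - 2)) / ((N + 1) * (N + 2))) := by field_simp
    rw [this]
    refine mul_le_of_le_one_right (by positivity) ?_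
    rwa [div_le_one (by positivity)]

/-- The weighted (double-sum) Jensen inequality of first order. It is Bessel's inequality for the
weight `N - i` and the orthogonal polynomials `1` and `3i + 1 - N`. -/
lemma double_sum_scalar {N : ℕ} (hN : 1 ≤ N) (x : ℕ → ℝ) :
    2 * ((N : ℝ) + 1) / N * ((x 0 - (T N)⁻¹ * ∑ j ∈ Finset.range (N + 1), x j) ^ 2
      + 2 * c₃ N * (x 0 - 4 * ((T N)⁻¹ * ∑ j ∈ Finset.range (N + 1), x j)
          + 3 * ((γ N)⁻¹ * ∑ j ∈ Finset.range (N + 1), ((j : ℝ) + 1) * x j)) ^ 2)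
      ≤ ∑ i ∈ Finset.range N, ((N : ℝ) - i) * (x (i + 1) - x i) ^ 2 := by
  have hN' : (1 : ℝ) ≤ N := by exact_mod_cast hN
  have hc3 := c₃_mul_sub_one_le hN
  have h3 : 0 ≤ c₃ N := zero_le_one.trans (one_le_c₃ hN)
  have key := bessel_three (N := N) (w := fun i => N - i) (p := fun _ => 1)
    (q := fun i => 3 * i + 1 - N) (r := fun i => 0)
    (K := 1) (a := 2 / (N * (N + 1))) (b := 4 * c₃ N / (N * (N + 1) * (N + 2) ^ 2)) (c := 0)
    (fun i => x (i + 1) - x i) (fun i hi => sub_nonneg.2 (by exact_mod_cast hi.le)) zero_lt_one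
    (by positivity) (by positivity) le_rfl
    (sum_range_eq_of_quartic (N * (1 - N)) (4 * N - 1) (-3) 0 0 (fun i => by ring) (by ring))
    (by simp) (by simp) ?_ ?_ (by simp)
  · have e0 : ∑ i ∈ Finset.range N, (((N : ℝ) - i) * (1 * (x (i + 1) - x i))) = _ :=
      sum_range_quadratic_mul_sub (x := x) (N + 1) (-1) 0 fun i => by ring
    have e1 : ∑ i ∈ Finset.range N, (((N : ℝ) - i) * ((3 * i + 1 - N) * (x (i + 1) - x i))) = _ :=
      sum_range_quadratic_mul_sub (x := x)
        (-(N + 1) * (N + 2)) (4 * (N + 2)) (-3) fun i => by ring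
    rw [e0, e1, one_mul] at key
    refine le_of_eq_of_le ?_ key
    unfold γ T
    field_simp
    ring
  · rw [sum_range_eq_of_quartic (S := N * (N + 1) / 2) N (-1) 0 0 0
      (fun i => by ring) (by ring)]
    apply le_of_eq
    field_simp
  · rw [sum_range_eq_of_quartic (S := N * (N + 1) * (N + 2) * (N - 1) / 4)
      (N * (1 - N) ^ 2) (6 * N * (1 - N) - (1 - N) ^ 2) (9 * N - 6 * (1 - N)) (-9) 0
      (fun i => by ring) (by ring)]
    have : 4 * c₃ N / ((N : ℝ) * (N + 1) * (N + 2) ^ 2) * (N * (N + 1) * (N + 2) * (N - 1) / 4)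
        = c₃ N * (N - 1) / (N + 2) := by field_simp
    rw [this]
    rwa [div_le_one (by positivity)]

/-! ### Summation inequalities for positive semidefinite forms -/

section mean

variable {ι : Type*}

/-- The average `(N+1)⁻¹ ∑_{j ≤ N} x_j`. -/
def mean (N : ℕ) (x : ℕ → ι → ℝ) : ι → ℝ := (T N)⁻¹ • ∑ j ∈ Finset.range (N + 1), x j

/-- The double average `γ(N)⁻¹ ∑_{j ≤ N} (j+1) x_j`. -/
def mean₂ (N : ℕ) (x : ℕ → ι → ℝ) : ι → ℝ :=
  (γ N)⁻¹ • ∑ j ∈ Finset.range (N + 1), ((j : ℝ) + 1) • x j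

@[simp] lemma mean_zero_left (x : ℕ → ι → ℝ) : mean 0 x = x 0 := by simp [mean, T]

@[simp] lemma mean₂_zero_left (x : ℕ → ι → ℝ) : mean₂ 0 x = x 0 := by
  simp [mean₂, γ, T]

lemma T_smul_mean (N : ℕ) (x : ℕ → ι → ℝ) :
    T N • mean N x = ∑ j ∈ Finset.range (N + 1), x j := by
  rw [mean, smul_smul, mul_inv_cancel₀ (by unfold T; positivity), one_smul]

lemma γ_smul_mean₂ (N : ℕ) (x : ℕ → ι → ℝ) :
    γ N • mean₂ N x = ∑ j ∈ Finset.range (N + 1), ((j : ℝ) + 1) • x j := by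
  rw [mean₂, smul_smul, mul_inv_cancel₀ (by unfold γ T; positivity), one_smul]

end mean

/-- The quadratic form `v ↦ vᵀ M v`. -/
def quad {ι : Type*} [Fintype ι] (M : Matrix ι ι ℝ) (v : ι → ℝ) : ℝ := v ⬝ᵥ (M *ᵥ v)

section quad

variable {ι : Type*} [Fintype ι]

@[simp] lemma quad_zero (M : Matrix ι ι ℝ) : quad M 0 = 0 := by simp [quad]

lemma quad_neg (M : Matrix ι ι ℝ) (v : ι → ℝ) : quad M (-v) = quad M v := by
  simp [quad, mulVec_neg]

lemma quad_smul (M : Matrix ι ι ℝ) (a : ℝ) (v : ι → ℝ) : quad M (a • v) = a ^ 2 * quad M v := by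
  simp [quad, mulVec_smul]; ring

lemma continuous_quad (M : Matrix ι ι ℝ) : Continuous (quad M) := by
  unfold quad; fun_prop

lemma quad_nonneg {M : Matrix ι ι ℝ} (hM : M.PosSemidef) (v : ι → ℝ) : 0 ≤ quad M v := by
  simpa [quad] using hM.dotProduct_mulVec_nonneg v

/-- A positive semidefinite quadratic form is a finite sum of squares of linear forms. This
transfers scalar inequalities between sums of squares to positive semidefinite forms. -/
lemma exists_quad_eq_sum_sq {M : Matrix ι ι ℝ} (hM : M.PosSemidef) :
    ∃ (m : ℕ) (L : Fin m → (ι → ℝ) →ₗ[ℝ] ℝ), ∀ v, quad M v = ∑ a, L a v ^ 2 := by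
  obtain ⟨m, u, rfl⟩ := posSemidef_iff_eq_sum_vecMulVec.1 hM
  refine ⟨m, fun a => dotProductBilin ℝ ℝ (u a), fun v => ?_⟩
  simp only [quad, sum_mulVec, dotProduct_sum]
  refine Finset.sum_congr rfl fun a _ => ?_
  simp [vecMulVec_mulVec, dotProduct_comm v (u a)]
  ring

lemma wirtinger {N : ℕ} (hN : 1 ≤ N) {R : Matrix ι ι ℝ} (hR : R.PosSemidef) (x : ℕ → ι → ℝ) :
    quad R (x N - x 0) + 3 * c₁ N * quad R (x N + x 0 - (2 : ℝ) • mean N x)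
      + 5 * c₂ N * quad R (x N - x 0 + (6 : ℝ) • mean N x - (6 : ℝ) • mean₂ N x)
      ≤ N * ∑ i ∈ Finset.range N, quad R (x (i + 1) - x i) := by
  obtain ⟨m, L, hL⟩ := exists_quad_eq_sum_sq hR
  simp only [hL]
  rw [Finset.sum_comm]
  simp only [Finset.mul_sum (s := (Finset.univ : Finset (Fin m))), ← Finset.sum_add_distrib]
  refine Finset.sum_le_sum fun a _ => ?_
  have := wirtinger_scalar hN fun j => L a (x j)
  simpa only [mean, mean₂, map_add, map_sub, map_smul, map_sum, smul_eq_mul] using this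

lemma double_sum {N : ℕ} (hN : 1 ≤ N) {S : Matrix ι ι ℝ} (hS : S.PosSemidef) (x : ℕ → ι → ℝ) :
    2 * ((N : ℝ) + 1) / N * (quad S (x 0 - mean N x)
      + 2 * c₃ N * quad S (x 0 - (4 : ℝ) • mean N x + (3 : ℝ) • mean₂ N x))
      ≤ ∑ i ∈ Finset.range N, ((N : ℝ) - i) * quad S (x (i + 1) - x i) := by
  obtain ⟨m, L, hL⟩ := exists_quad_eq_sum_sq hS
  simp only [hL]
  simp only [Finset.mul_sum (s := (Finset.univ : Finset (Fin m))), ← Finset.sum_add_distrib]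
  rw [Finset.sum_comm]
  refine Finset.sum_le_sum fun a _ => ?_
  have := double_sum_scalar hN fun j => L a (x j)
  simpa only [mean, mean₂, map_add, map_sub, map_smul, map_sum, smul_eq_mul] using this

/-- The form of `wirtinger` with the constants replaced by lower bounds which do not depend on `N`;
it holds for `N = 0` too, where both sides vanish. -/
lemma wirtinger_uniform (N : ℕ) {R : Matrix ι ι ℝ} (hR : R.PosSemidef) (x : ℕ → ι → ℝ) :
    quad R (x N - x 0) + 3 * quad R (x N + x 0 - (2 : ℝ) • mean N x)
      + 5 * quad R (x N - x 0 + (6 : ℝ) • mean N x - (6 : ℝ) • mean₂ N x)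
      ≤ N * ∑ i ∈ Finset.range N, quad R (x (i + 1) - x i) := by
  rcases N.eq_zero_or_pos with rfl | hN
  · simp [two_smul]
  · have h1 := mul_le_mul_of_nonneg_right (one_le_c₁ hN)
      (quad_nonneg hR (x N + x 0 - (2 : ℝ) • mean N x))
    have h2 := mul_le_mul_of_nonneg_right (one_le_c₂ hN)
      (quad_nonneg hR (x N - x 0 + (6 : ℝ) • mean N x - (6 : ℝ) • mean₂ N x))
    linarith [wirtinger hN hR x]

/-- The form of `double_sum` with the constants replaced by lower bounds which do not depend on
`N`; it holds for `N = 0` too, where both sides vanish. -/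
lemma double_sum_uniform (N : ℕ) {S : Matrix ι ι ℝ} (hS : S.PosSemidef) (x : ℕ → ι → ℝ) :
    2 * quad S (x 0 - mean N x) + 4 * quad S (x 0 - (4 : ℝ) • mean N x + (3 : ℝ) • mean₂ N x)
      ≤ ∑ i ∈ Finset.range N, ((N : ℝ) - i) * quad S (x (i + 1) - x i) := by
  rcases N.eq_zero_or_pos with rfl | hN
  · have : x 0 - (4 : ℝ) • x 0 + (3 : ℝ) • x 0 = 0 := by module
    simp [this]
  · refine le_trans ?_ (double_sum hN hS x)
    have h0 := quad_nonneg hS (x 0 - mean N x)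
    have h1 := quad_nonneg hS (x 0 - (4 : ℝ) • mean N x + (3 : ℝ) • mean₂ N x)
    have h2 := mul_le_mul_of_nonneg_right (one_le_c₃ hN) h1
    have hN' : (0 : ℝ) < N := by exact_mod_cast hN
    have h3 : 2 ≤ 2 * ((N : ℝ) + 1) / N := by rw [le_div_iff₀ hN']; linarith
    have h4 := mul_le_mul_of_nonneg_right h3 (add_nonneg h0 (mul_nonneg zero_le_two h1))
    have h5 := mul_le_mul_of_nonneg_left h2 (zero_le_two.trans h3)
    linarith

end quad

/-! ### Evaluating the block matrices -/

section quad

variable {ι κ : Type*} [Fintype ι] [Fintype κ]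

lemma quad_add_matrix (M N : Matrix ι ι ℝ) (v : ι → ℝ) :
    quad (M + N) v = quad M v + quad N v := by
  simp [quad, add_mulVec]

lemma quad_sub_matrix (M N : Matrix ι ι ℝ) (v : ι → ℝ) :
    quad (M - N) v = quad M v - quad N v := by
  simp [quad, sub_mulVec]

lemma quad_smul_matrix (a : ℝ) (M : Matrix ι ι ℝ) (v : ι → ℝ) :
    quad (a • M) v = a * quad M v := by
  simp [quad, smul_mulVec]

lemma dotProduct_transpose_mul_mulVec (B C : Matrix κ ι ℝ) (M : Matrix κ κ ℝ) (v : ι → ℝ) :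
    v ⬝ᵥ ((Bᵀ * M * C) *ᵥ v) = (B *ᵥ v) ⬝ᵥ (M *ᵥ (C *ᵥ v)) := by
  rw [← mulVec_mulVec, ← mulVec_mulVec, dotProduct_mulVec, vecMul_transpose]

lemma quad_congruence (B : Matrix κ ι ℝ) (M : Matrix κ κ ℝ) (v : ι → ℝ) :
    quad (Bᵀ * M * B) v = quad M (B *ᵥ v) :=
  dotProduct_transpose_mul_mulVec B B M v

lemma quad_He (M : Matrix ι ι ℝ) (v : ι → ℝ) : quad (He M) v = 2 * (v ⬝ᵥ (M *ᵥ v)) := by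
  rw [He, quad_add_matrix, quad, quad, mulVec_transpose, dotProduct_comm v (v ᵥ* M),
    ← dotProduct_mulVec]
  ring

lemma quad_sub {M : Matrix ι ι ℝ} (hM : Mᵀ = M) (u v : ι → ℝ) :
    quad M (u - v) = quad M u - 2 * (u ⬝ᵥ (M *ᵥ v)) + quad M v := by
  have : v ⬝ᵥ (M *ᵥ u) = u ⬝ᵥ (M *ᵥ v) := by
    rw [dotProduct_mulVec, ← mulVec_transpose, hM, dotProduct_comm]
  simp only [quad, mulVec_sub, dotProduct_sub, sub_dotProduct, this]
  ring

end quad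

variable {n : ℕ}

/-- The vector whose `i`-th block is `z i`. -/
def ofBlocks {m : ℕ} (z : Fin m → Fin n → ℝ) : Fin n × Fin m → ℝ := fun p => z p.2 p.1

lemma continuous_ofBlocks {m : ℕ} : Continuous (ofBlocks (n := n) (m := m)) := by
  unfold ofBlocks; fun_prop

lemma ofBlocks_zero {m : ℕ} : ofBlocks (0 : Fin m → Fin n → ℝ) = 0 := rfl

lemma ofBlocks_sub {m : ℕ} (z w : Fin m → Fin n → ℝ) :
    ofBlocks (z - w) = ofBlocks z - ofBlocks w := rfl

lemma col_mulVec {m : ℕ} (B : Fin m → Row n) (v : Fin n × Fin 10 → ℝ) :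
    col B *ᵥ v = ofBlocks fun i => B i *ᵥ v := rfl

lemma e_mulVec (z : Fin 10 → Fin n → ℝ) (j : Fin 10) : e n (j + 1) *ᵥ ofBlocks z = z j := by
  ext a
  simp only [mulVec, dotProduct, e, of_apply, ofBlocks, add_left_inj, ite_mul, one_mul, zero_mul]
  rw [Finset.sum_eq_single (a, j)]
  · simp
  · rintro ⟨b, i⟩ - h
    refine if_neg fun h' => h ?_
    rw [Prod.mk.injEq]
    exact ⟨h'.2, Fin.ext h'.1⟩
  · simp

lemma calA_mulVec (A Ad : Matrix (Fin n) (Fin n) ℝ) (z : Fin 10 → Fin n → ℝ) :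
    calA A Ad *ᵥ ofBlocks z = A *ᵥ z 0 + Ad *ᵥ z 2 - z 0 := by
  have h1 : e n 1 *ᵥ ofBlocks z = z 0 := e_mulVec z 0
  have h3 : e n 3 *ᵥ ofBlocks z = z 2 := e_mulVec z 2
  rw [calA, add_mulVec, ← mulVec_mulVec, ← mulVec_mulVec, h1, h3, sub_mulVec, one_mulVec]
  abel

lemma quad_blockDiagonal {m : ℕ} (D : Fin m → Matrix (Fin n) (Fin n) ℝ)
    (z : Fin m → Fin n → ℝ) : quad (blockDiagonal D) (ofBlocks z) = ∑ i, quad (D i) (z i) := by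
  simp only [quad, dotProduct, mulVec, ofBlocks, blockDiagonal_apply, Fintype.sum_prod_type,
    ite_mul, zero_mul, Finset.sum_ite_eq, Finset.mem_univ, if_true]
  exact Finset.sum_comm

section blocks

variable (A Ad : Matrix (Fin n) (Fin n) ℝ) (P : Matrix (Fin n × Fin 4) (Fin n × Fin 4) ℝ)
  (Q₁ Q₂ R₁ R₂ S₁ S₂ : Matrix (Fin n) (Fin n) ℝ) (X : Matrix (Fin n × Fin 3) (Fin n × Fin 3) ℝ)
  (h₁ h₂ h : ℝ) (z : Fin 10 → Fin n → ℝ)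

lemma Ω_mulVec : Ω n h₁ h₂ h *ᵥ ofBlocks z = ofBlocks
    ![z 0, T h₁ • z 4, T (h - h₁) • z 5 + T (h₂ - h) • z 6, γ h₁ • z 7] := by
  have e1 : e n 1 *ᵥ ofBlocks z = z 0 := e_mulVec z 0
  have e5 : e n 5 *ᵥ ofBlocks z = z 4 := e_mulVec z 4
  have e6 : e n 6 *ᵥ ofBlocks z = z 5 := e_mulVec z 5
  have e7 : e n 7 *ᵥ ofBlocks z = z 6 := e_mulVec z 6
  have e8 : e n 8 *ᵥ ofBlocks z = z 7 := e_mulVec z 7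
  rw [Ω, col_mulVec]
  congr 1
  ext1 i
  fin_cases i <;> simp [add_mulVec, smul_mulVec, e1, e5, e6, e7, e8]

lemma Ω₁_mulVec : Ω₁ A Ad h₁ *ᵥ ofBlocks z = ofBlocks
    ![z 0 - (A *ᵥ z 0 + Ad *ᵥ z 2), z 1, z 2 + z 3, T h₁ • z 4] := by
  have e2 : e n 2 *ᵥ ofBlocks z = z 1 := e_mulVec z 1
  have e3 : e n 3 *ᵥ ofBlocks z = z 2 := e_mulVec z 2
  have e4 : e n 4 *ᵥ ofBlocks z = z 3 := e_mulVec z 3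
  have e5 : e n 5 *ᵥ ofBlocks z = z 4 := e_mulVec z 4
  rw [Ω₁, col_mulVec]
  congr 1
  ext1 i
  fin_cases i <;> simp [add_mulVec, smul_mulVec, neg_mulVec, calA_mulVec, e2, e3, e4, e5]

lemma Ω₂_mulVec : Ω₂ n h₁ *ᵥ ofBlocks z = ofBlocks ![0, z 0, z 1 + z 2, T h₁ • z 0] := by
  have e1 : e n 1 *ᵥ ofBlocks z = z 0 := e_mulVec z 0
  have e2 : e n 2 *ᵥ ofBlocks z = z 1 := e_mulVec z 1
  have e3 : e n 3 *ᵥ ofBlocks z = z 2 := e_mulVec z 2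
  rw [Ω₂, col_mulVec]
  congr 1
  ext1 i
  fin_cases i <;> simp [add_mulVec, smul_mulVec, e1, e2, e3]

lemma Γ₁_mulVec : Γ₁ n *ᵥ ofBlocks z = ofBlocks ![z 0 - z 1, z 0 + z 1 - (2 : ℝ) • z 4,
    z 0 - z 1 + (6 : ℝ) • z 4 - (6 : ℝ) • z 7] := by
  have e1 : e n 1 *ᵥ ofBlocks z = z 0 := e_mulVec z 0
  have e2 : e n 2 *ᵥ ofBlocks z = z 1 := e_mulVec z 1
  have e5 : e n 5 *ᵥ ofBlocks z = z 4 := e_mulVec z 4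
  have e8 : e n 8 *ᵥ ofBlocks z = z 7 := e_mulVec z 7
  rw [Γ₁, col_mulVec]
  congr 1
  ext1 i
  fin_cases i <;> simp [add_mulVec, sub_mulVec, smul_mulVec, e1, e2, e5, e8]

lemma Γ₂_mulVec : Γ₂ n *ᵥ ofBlocks z = ofBlocks ![z 1 - z 2, z 1 + z 2 - (2 : ℝ) • z 5,
    z 1 - z 2 + (6 : ℝ) • z 5 - (6 : ℝ) • z 8] := by
  have e2 : e n 2 *ᵥ ofBlocks z = z 1 := e_mulVec z 1
  have e3 : e n 3 *ᵥ ofBlocks z = z 2 := e_mulVec z 2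
  have e6 : e n 6 *ᵥ ofBlocks z = z 5 := e_mulVec z 5
  have e9 : e n 9 *ᵥ ofBlocks z = z 8 := e_mulVec z 8
  rw [Γ₂, col_mulVec]
  congr 1
  ext1 i
  fin_cases i <;> simp [add_mulVec, sub_mulVec, smul_mulVec, e2, e3, e6, e9]

lemma Γ₃_mulVec : Γ₃ n *ᵥ ofBlocks z = ofBlocks ![z 2 - z 3, z 2 + z 3 - (2 : ℝ) • z 6,
    z 2 - z 3 + (6 : ℝ) • z 6 - (6 : ℝ) • z 9] := by
  have e3 : e n 3 *ᵥ ofBlocks z = z 2 := e_mulVec z 2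
  have e4 : e n 4 *ᵥ ofBlocks z = z 3 := e_mulVec z 3
  have e7 : e n 7 *ᵥ ofBlocks z = z 6 := e_mulVec z 6
  have e10 : e n 10 *ᵥ ofBlocks z = z 9 := e_mulVec z 9
  rw [Γ₃, col_mulVec]
  congr 1
  ext1 i
  fin_cases i <;> simp [add_mulVec, sub_mulVec, smul_mulVec, e3, e4, e7, e10]

lemma Γ₄_mulVec : Γ₄ n *ᵥ ofBlocks z =
    ofBlocks ![z 1 - z 4, z 1 - (4 : ℝ) • z 4 + (3 : ℝ) • z 7] := by
  have e2 : e n 2 *ᵥ ofBlocks z = z 1 := e_mulVec z 1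
  have e5 : e n 5 *ᵥ ofBlocks z = z 4 := e_mulVec z 4
  have e8 : e n 8 *ᵥ ofBlocks z = z 7 := e_mulVec z 7
  rw [Γ₄, col_mulVec]
  congr 1
  ext1 i
  fin_cases i <;> simp [add_mulVec, sub_mulVec, smul_mulVec, e2, e5, e8]

lemma Γ₅_mulVec : Γ₅ n *ᵥ ofBlocks z = ofBlocks ![z 2 - z 5, z 3 - z 6] := by
  have e3 : e n 3 *ᵥ ofBlocks z = z 2 := e_mulVec z 2
  have e4 : e n 4 *ᵥ ofBlocks z = z 3 := e_mulVec z 3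
  have e6 : e n 6 *ᵥ ofBlocks z = z 5 := e_mulVec z 5
  have e7 : e n 7 *ᵥ ofBlocks z = z 6 := e_mulVec z 6
  rw [Γ₅, col_mulVec]
  congr 1
  ext1 i
  fin_cases i <;> simp [sub_mulVec, e3, e4, e6, e7]

lemma Γ₆_mulVec : Γ₆ n *ᵥ ofBlocks z = ofBlocks
    ![z 2 - (4 : ℝ) • z 5 + (3 : ℝ) • z 8, z 3 - (4 : ℝ) • z 6 + (3 : ℝ) • z 9] := by
  have e3 : e n 3 *ᵥ ofBlocks z = z 2 := e_mulVec z 2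
  have e4 : e n 4 *ᵥ ofBlocks z = z 3 := e_mulVec z 3
  have e6 : e n 6 *ᵥ ofBlocks z = z 5 := e_mulVec z 5
  have e7 : e n 7 *ᵥ ofBlocks z = z 6 := e_mulVec z 6
  have e9 : e n 9 *ᵥ ofBlocks z = z 8 := e_mulVec z 8
  have e10 : e n 10 *ᵥ ofBlocks z = z 9 := e_mulVec z 9
  rw [Γ₆, col_mulVec]
  congr 1
  ext1 i
  fin_cases i <;> simp [add_mulVec, sub_mulVec, smul_mulVec, e3, e4, e6, e7, e9, e10]

lemma quad_Pi₀ (v : Fin n × Fin 10 → ℝ) : quad (Pi₀ A Ad P h₁ h₂ h) v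
    = 2 * ((Ω n h₁ h₂ h *ᵥ v) ⬝ᵥ (P *ᵥ ((Ω₂ n h₁ - Ω₁ A Ad h₁) *ᵥ v)))
      + quad P (Ω₁ A Ad h₁ *ᵥ v) - quad P (Ω₂ n h₁ *ᵥ v) := by
  rw [Pi₀, quad_sub_matrix, quad_add_matrix, quad_congruence, quad_congruence, quad_He,
    dotProduct_transpose_mul_mulVec]

/-- `Π₀(h)` is the increment of `P` from `Ω(h) - Ω₂` (the current augmented state) to
`Ω(h) - Ω₁` (the next one). -/
lemma quad_Pi₀_eq_sub {P : Matrix (Fin n × Fin 4) (Fin n × Fin 4) ℝ} (hP : Pᵀ = P)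
    (v : Fin n × Fin 10 → ℝ) : quad (Pi₀ A Ad P h₁ h₂ h) v
    = quad P (Ω n h₁ h₂ h *ᵥ v - Ω₁ A Ad h₁ *ᵥ v) - quad P (Ω n h₁ h₂ h *ᵥ v - Ω₂ n h₁ *ᵥ v) := by
  rw [quad_Pi₀, quad_sub hP, quad_sub hP, sub_mulVec, mulVec_sub, dotProduct_sub]
  ring

lemma quad_Pi₁ : quad (Pi₁ Q₁ Q₂) (ofBlocks z)
    = quad Q₁ (z 0) - quad Q₁ (z 1) + quad Q₂ (z 1) - quad Q₂ (z 3) := by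
  have e1 : e n 1 *ᵥ ofBlocks z = z 0 := e_mulVec z 0
  have e2 : e n 2 *ᵥ ofBlocks z = z 1 := e_mulVec z 1
  have e4 : e n 4 *ᵥ ofBlocks z = z 3 := e_mulVec z 3
  simp only [Pi₁, quad_add_matrix, quad_sub_matrix, quad_congruence, e1, e2, e4]

lemma quad_Pi₂ (v : Fin n × Fin 10 → ℝ) : quad (Pi₂ A Ad R₁ R₂ S₁ S₂ h₁ h₂) v
    = h₁ ^ 2 * quad R₁ (calA A Ad *ᵥ v) + (h₂ - h₁) ^ 2 * quad R₂ (calA A Ad *ᵥ v)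
      + γ (h₁ - 1) * quad S₁ (calA A Ad *ᵥ v) + γ (h₂ - h₁ - 1) * quad S₂ (calA A Ad *ᵥ v) := by
  simp only [Pi₂, quad_congruence, quad_add_matrix, quad_smul_matrix]

lemma quad_Pi₃ : quad (Pi₃ R₁ h₁) (ofBlocks z)
    = quad R₁ (z 0 - z 1) + 3 * c₁ h₁ * quad R₁ (z 0 + z 1 - (2 : ℝ) • z 4)
      + 5 * c₂ h₁ * quad R₁ (z 0 - z 1 + (6 : ℝ) • z 4 - (6 : ℝ) • z 7) := by
  simp [Pi₃, quad_congruence, Γ₁_mulVec, Rt₁, quad_blockDiagonal, Fin.sum_univ_three,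
    quad_smul_matrix]

lemma quad_Rt₂ (w : Fin 3 → Fin n → ℝ) : quad (Rt₂ R₂) (ofBlocks w)
    = quad R₂ (w 0) + 3 * quad R₂ (w 1) + 5 * quad R₂ (w 2) := by
  simp [Rt₂, quad_blockDiagonal, Fin.sum_univ_three, quad_smul_matrix]

lemma quad_Pi₄ (v : Fin n × Fin 10 → ℝ) : quad (Pi₄ R₂ X) v
    = quad (couplingMatrix R₂ X) (Sum.elim (Γ₂ n *ᵥ v) (Γ₃ n *ᵥ v)) := by
  rw [Pi₄, quad_congruence, fromRows_mulVec]

lemma quad_couplingMatrix (u w : Fin n × Fin 3 → ℝ) :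
    quad (couplingMatrix R₂ X) (Sum.elim u w)
      = quad (Rt₂ R₂) u + 2 * (u ⬝ᵥ (X *ᵥ w)) + quad (Rt₂ R₂) w := by
  have : w ⬝ᵥ (Xᵀ *ᵥ u) = u ⬝ᵥ (X *ᵥ w) := by
    rw [mulVec_transpose, dotProduct_comm, ← dotProduct_mulVec]
  simp only [couplingMatrix, quad, fromBlocks_mulVec, Sum.elim_comp_inl, Sum.elim_comp_inr,
    sumElim_dotProduct_sumElim, dotProduct_add, this]
  ring

lemma quad_Pi₅ : quad (Pi₅ S₁ h₁) (ofBlocks z)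
    = 2 * (h₁ + 1) / h₁ * (quad S₁ (z 1 - z 4)
      + 2 * c₃ h₁ * quad S₁ (z 1 - (4 : ℝ) • z 4 + (3 : ℝ) • z 7)) := by
  simp [Pi₅, quad_congruence, Γ₄_mulVec, Sh₁, quad_blockDiagonal, Fin.sum_univ_two,
    quad_smul_matrix]

lemma quad_Pi₆ : quad (Pi₆ S₂) (ofBlocks z)
    = 2 * (quad S₂ (z 2 - z 5) + quad S₂ (z 3 - z 6))
      + 4 * (quad S₂ (z 2 - (4 : ℝ) • z 5 + (3 : ℝ) • z 8)
        + quad S₂ (z 3 - (4 : ℝ) • z 6 + (3 : ℝ) • z 9)) := by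
  simp [Pi₆, quad_congruence, Γ₅_mulVec, Γ₆_mulVec, Sh₂, quad_blockDiagonal, Fin.sum_univ_two,
    quad_smul_matrix, quad_add_matrix]

/-- `Π(h)` is affine in `h`, because `Ω(h)` is and the other blocks do not depend on `h`. -/
lemma quad_PiMatrix_affine {a b : ℝ} (hab : a + b = 1) (h' : ℝ) :
    quad (PiMatrix A Ad P Q₁ Q₂ R₁ R₂ S₁ S₂ X h₁ h₂ (a * h + b * h')) (ofBlocks z)
      = a * quad (PiMatrix A Ad P Q₁ Q₂ R₁ R₂ S₁ S₂ X h₁ h₂ h) (ofBlocks z)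
        + b * quad (PiMatrix A Ad P Q₁ Q₂ R₁ R₂ S₁ S₂ X h₁ h₂ h') (ofBlocks z) := by
  have hΩ : Ω n h₁ h₂ (a * h + b * h') *ᵥ ofBlocks z
      = a • Ω n h₁ h₂ h *ᵥ ofBlocks z + b • Ω n h₁ h₂ h' *ᵥ ofBlocks z := by
    obtain rfl : b = 1 - a := by linarith
    simp only [Ω_mulVec]
    ext ⟨i, j⟩
    fin_cases j <;> simp [ofBlocks, T] <;> ring
  obtain rfl : b = 1 - a := by linarith
  simp only [PiMatrix, quad_sub_matrix, quad_add_matrix, quad_Pi₀, hΩ, add_dotProduct,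
    smul_dotProduct, smul_eq_mul]
  ring

end blocks

/-- The reciprocally convex combination inequality: if `p E ≥ R̃₂[u]` and `q F ≥ R̃₂[w]`, then
`(p + q)(E + F)` dominates the coupled form at `(u, w)`. For `p, q > 0` the cross terms are
estimated by the coupled form at `(q u, -p w)`. -/
lemma coupling_le {R₂ : Matrix (Fin n) (Fin n) ℝ} {X : Matrix (Fin n × Fin 3) (Fin n × Fin 3) ℝ}
    (hC : (couplingMatrix R₂ X).PosSemidef) {p q E F : ℝ} (hp : 0 ≤ p) (hq : 0 ≤ q)
    {u w : Fin n × Fin 3 → ℝ} (hu : quad (Rt₂ R₂) u ≤ p * E) (hw : quad (Rt₂ R₂) w ≤ q * F)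
    (hu0 : p = 0 → u = 0 ∧ E = 0) (hw0 : q = 0 → w = 0 ∧ F = 0) :
    quad (couplingMatrix R₂ X) (Sum.elim u w) ≤ (p + q) * (E + F) := by
  rw [quad_couplingMatrix]
  rcases hp.eq_or_lt with rfl | hp'
  · obtain ⟨rfl, rfl⟩ := hu0 rfl
    simpa using hw
  rcases hq.eq_or_lt with rfl | hq'
  · obtain ⟨rfl, rfl⟩ := hw0 rfl
    simpa using hu
  have key := quad_nonneg hC (Sum.elim (q • u) (-(p • w)))
  rw [quad_couplingMatrix, quad_neg, quad_smul, quad_smul, mulVec_neg, mulVec_smul,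
    dotProduct_neg, dotProduct_smul, smul_dotProduct, smul_eq_mul, smul_eq_mul] at key
  have h1 := mul_le_mul_of_nonneg_left hu (sq_nonneg q)
  have h2 := mul_le_mul_of_nonneg_left hw (sq_nonneg p)
  have h3 : 2 * (u ⬝ᵥ (X *ᵥ w)) ≤ q * E + p * F := by
    refine le_of_mul_le_mul_left ?_ (mul_pos hp' hq')
    linarith
  linarith

/-! ### The Lyapunov functional -/

lemma sum_range_shift_sub (f : ℕ → ℝ) (a N : ℕ) :
    ∑ j ∈ Finset.range N, f (a + j + 1) - ∑ j ∈ Finset.range N, f (a + j) = f (a + N) - f a := by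
  rw [← Finset.sum_sub_distrib]
  exact Finset.sum_range_sub (fun j => f (a + j)) N

/-- `∑_{i < N} w_i ∑_{a + i ≤ v < b} f_v`: the multiple-sum part of the Lyapunov functional. -/
def tailSum (N a b : ℕ) (w f : ℕ → ℝ) : ℝ :=
  ∑ i ∈ Finset.range N, w i * ∑ v ∈ Finset.Ico (a + i) b, f v

lemma tailSum_nonneg {N a b : ℕ} {w f : ℕ → ℝ} (hw : ∀ i < N, 0 ≤ w i) (hf : ∀ v, 0 ≤ f v) :
    0 ≤ tailSum N a b w f :=
  Finset.sum_nonneg fun i hi =>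
    mul_nonneg (hw i (Finset.mem_range.1 hi)) (Finset.sum_nonneg fun v _ => hf v)

lemma tailSum_shift_sub {N a b : ℕ} (hab : a + N ≤ b) (w f : ℕ → ℝ) :
    tailSum N a b w (fun v => f (v + 1)) - tailSum N a b w f
      = (∑ i ∈ Finset.range N, w i) * f b - ∑ i ∈ Finset.range N, w i * f (a + i) := by
  rw [tailSum, tailSum, ← Finset.sum_sub_distrib, Finset.sum_mul, ← Finset.sum_sub_distrib]
  refine Finset.sum_congr rfl fun i hi => ?_
  have hi' := Finset.mem_range.1 hi
  rw [← mul_sub, ← mul_sub, Finset.sum_Ico_eq_sum_range, Finset.sum_Ico_eq_sum_range,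
    sum_range_shift_sub, Nat.add_sub_cancel' (by omega)]

/-- The augmented state formed from the history `Y 0, …, Y (M + N)`, whose last entry is the
current state: here `N = h₁` and `M = h₂ - h₁`. -/
def augState (N M : ℕ) (Y : ℕ → Fin n → ℝ) : Fin 4 → Fin n → ℝ :=
  ![Y (M + N), ∑ j ∈ Finset.range N, Y (M + j), ∑ j ∈ Finset.range M, Y j,
    ∑ j ∈ Finset.range N, ((j : ℝ) + 1) • Y (M + j)]

/-- The Lyapunov functional on histories `Y 0, …, Y (M + N)`, where `N = h₁` and `M = h₂ - h₁`.
The weights `N - i` and `M - i` of the `S`-terms decrease away from the oldest entry of the window,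
so that the sums they leave in the increment are those of `double_sum`. -/
def lyapunov (P : Matrix (Fin n × Fin 4) (Fin n × Fin 4) ℝ)
    (Q₁ Q₂ R₁ R₂ S₁ S₂ : Matrix (Fin n) (Fin n) ℝ) (N M : ℕ) (Y : ℕ → Fin n → ℝ) : ℝ :=
  quad P (ofBlocks (augState N M Y))
    + ∑ j ∈ Finset.range N, quad Q₁ (Y (M + j)) + ∑ j ∈ Finset.range M, quad Q₂ (Y (0 + j))
    + tailSum N M (M + N) (fun _ => N) (fun v => quad R₁ (Y (v + 1) - Y v))
    + tailSum M 0 (M + N) (fun _ => M) (fun v => quad R₂ (Y (v + 1) - Y v))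
    + tailSum N M (M + N) (fun i => N - i) (fun v => quad S₁ (Y (v + 1) - Y v))
    + tailSum M 0 (M + N) (fun i => M - i) (fun v => quad S₂ (Y (v + 1) - Y v))

lemma quad_augState_le_lyapunov {P : Matrix (Fin n × Fin 4) (Fin n × Fin 4) ℝ}
    {Q₁ Q₂ R₁ R₂ S₁ S₂ : Matrix (Fin n) (Fin n) ℝ} (hQ₁ : Q₁.PosSemidef) (hQ₂ : Q₂.PosSemidef)
    (hR₁ : R₁.PosSemidef) (hR₂ : R₂.PosSemidef) (hS₁ : S₁.PosSemidef) (hS₂ : S₂.PosSemidef)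
    (N M : ℕ) (Y : ℕ → Fin n → ℝ) :
    quad P (ofBlocks (augState N M Y)) ≤ lyapunov P Q₁ Q₂ R₁ R₂ S₁ S₂ N M Y := by
  have h1 : 0 ≤ ∑ j ∈ Finset.range N, quad Q₁ (Y (M + j)) :=
    Finset.sum_nonneg fun j _ => quad_nonneg hQ₁ _
  have h2 : 0 ≤ ∑ j ∈ Finset.range M, quad Q₂ (Y (0 + j)) :=
    Finset.sum_nonneg fun j _ => quad_nonneg hQ₂ _
  have h3 := tailSum_nonneg (N := N) (a := M) (b := M + N) (w := fun _ => N)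
    (fun i _ => N.cast_nonneg) fun v => quad_nonneg hR₁ (Y (v + 1) - Y v)
  have h4 := tailSum_nonneg (N := M) (a := 0) (b := M + N) (w := fun _ => M)
    (fun i _ => M.cast_nonneg) fun v => quad_nonneg hR₂ (Y (v + 1) - Y v)
  have h5 := tailSum_nonneg (N := N) (a := M) (b := M + N) (w := fun i => N - i)
    (fun i hi => sub_nonneg.2 (by exact_mod_cast hi.le)) fun v => quad_nonneg hS₁ (Y (v + 1) - Y v)
  have h6 := tailSum_nonneg (N := M) (a := 0) (b := M + N) (w := fun i => M - i)
    (fun i hi => sub_nonneg.2 (by exact_mod_cast hi.le)) fun v => quad_nonneg hS₂ (Y (v + 1) - Y v)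
  unfold lyapunov
  linarith

/-- The vector of the ten states and averages at which `Π(h)` is evaluated, for the history
`Y 0, …, Y (c + d + N)` with `N = h₁`, `c = h - h₁` and `d = h₂ - h`. -/
def zeta (N c d : ℕ) (Y : ℕ → Fin n → ℝ) : Fin 10 → Fin n → ℝ :=
  ![Y (c + d + N), Y (c + d), Y d, Y 0,
    mean N fun j => Y (c + d + j), mean c fun j => Y (d + j), mean d Y,
    mean₂ N fun j => Y (c + d + j), mean₂ c fun j => Y (d + j), mean₂ d Y]

lemma sum_range_sub_self (N : ℕ) : ∑ i ∈ Finset.range N, ((N : ℝ) - i) = γ (N - 1) :=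
  sum_range_eq_of_quartic N (-1) 0 0 0 (fun i => by ring) (by unfold γ T; ring)

section decrease

variable {A Ad : Matrix (Fin n) (Fin n) ℝ} {P : Matrix (Fin n × Fin 4) (Fin n × Fin 4) ℝ}
  {Q₁ Q₂ R₁ R₂ S₁ S₂ : Matrix (Fin n) (Fin n) ℝ} {X : Matrix (Fin n × Fin 3) (Fin n × Fin 3) ℝ}
  {N c d : ℕ} {Y : ℕ → Fin n → ℝ}

/-- The current augmented state is `(Ω(h) - Ω₂) ζ`. -/
lemma ofBlocks_augState : ofBlocks (augState N (c + d) Y)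
    = Ω n N (N + (c + d) : ℕ) (N + c : ℕ) *ᵥ ofBlocks (zeta N c d Y)
      - Ω₂ n N *ᵥ ofBlocks (zeta N c d Y) := by
  have h1 : ((N + c : ℕ) : ℝ) - N = c := by push_cast; ring
  have h2 : ((N + (c + d) : ℕ) : ℝ) - (N + c : ℕ) = d := by push_cast; ring
  have h3 : ∑ j ∈ Finset.range (c + 1), Y (d + j) + ∑ j ∈ Finset.range (d + 1), Y j
      = ∑ j ∈ Finset.range (c + d), Y j + Y (c + d) + Y d := by
    rw [Finset.sum_range_succ, Finset.sum_range_succ, add_comm c d, Finset.sum_range_add]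
    abel
  rw [Ω_mulVec, Ω₂_mulVec, ← ofBlocks_sub, h1, h2]
  congr 1
  ext1 i
  fin_cases i
  · simp [augState, zeta]
  · simp [augState, zeta, T_smul_mean, Finset.sum_range_succ]
  · simp only [augState, zeta, T_smul_mean, h3, Fin.reduceFinMk, cons_val, Pi.sub_apply]
    abel
  · simp only [augState, zeta, γ_smul_mean₂, Finset.sum_range_succ, T, Fin.reduceFinMk,
      cons_val, Pi.sub_apply]
    abel

/-- The next augmented state is `(Ω(h) - Ω₁) ζ`. -/
lemma ofBlocks_augState_succ (hY : Y (c + d + N + 1) = A *ᵥ Y (c + d + N) + Ad *ᵥ Y d) :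
    ofBlocks (augState N (c + d) fun j => Y (j + 1))
    = Ω n N (N + (c + d) : ℕ) (N + c : ℕ) *ᵥ ofBlocks (zeta N c d Y)
      - Ω₁ A Ad N *ᵥ ofBlocks (zeta N c d Y) := by
  have h1 : ((N + c : ℕ) : ℝ) - N = c := by push_cast; ring
  have h2 : ((N + (c + d) : ℕ) : ℝ) - (N + c : ℕ) = d := by push_cast; ring
  have h3 : ∑ j ∈ Finset.range (c + 1), Y (d + j) + ∑ j ∈ Finset.range (d + 1), Y j
      = ∑ j ∈ Finset.range (c + d), Y (j + 1) + Y 0 + Y d := by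
    rw [← Finset.sum_range_succ', show c + d + 1 = d + (c + 1) by omega,
      Finset.sum_range_add _ d (c + 1), Finset.sum_range_succ _ d]
    abel
  rw [Ω_mulVec, Ω₁_mulVec, ← ofBlocks_sub, h1, h2]
  congr 1
  ext1 i
  fin_cases i
  · simp [augState, zeta, hY]
  · simp [augState, zeta, T_smul_mean, Finset.sum_range_succ', add_assoc]
  · simp only [augState, zeta, T_smul_mean, h3, Fin.reduceFinMk, cons_val, Pi.sub_apply]
    abel
  · simp only [augState, zeta, γ_smul_mean₂, T_smul_mean, Fin.reduceFinMk, cons_val,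
      Pi.sub_apply]
    rw [← Finset.sum_sub_distrib, Finset.sum_range_succ']
    simp only [Nat.cast_zero, zero_add, one_smul, add_zero, sub_self]
    refine Finset.sum_congr rfl fun j _ => ?_
    rw [← add_assoc]
    push_cast
    module

/-- Along a step of the system the Lyapunov functional increases by at most the quadratic form of
`Π(h)` at `ζ`: the summation inequalities bound the sums that the increment contains. -/
lemma lyapunov_succ_sub_le (hN : 1 ≤ N) (hP : Pᵀ = P)
    (hR₁ : R₁.PosSemidef) (hR₂ : R₂.PosSemidef) (hS₁ : S₁.PosSemidef) (hS₂ : S₂.PosSemidef)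
    (hC : (couplingMatrix R₂ X).PosSemidef)
    (hY : Y (c + d + N + 1) = A *ᵥ Y (c + d + N) + Ad *ᵥ Y d) :
    lyapunov P Q₁ Q₂ R₁ R₂ S₁ S₂ N (c + d) (fun j => Y (j + 1))
      - lyapunov P Q₁ Q₂ R₁ R₂ S₁ S₂ N (c + d) Y
    ≤ quad (PiMatrix A Ad P Q₁ Q₂ R₁ R₂ S₁ S₂ X N (N + (c + d) : ℕ) (N + c : ℕ))
      (ofBlocks (zeta N c d Y)) := by
  set δ := Y (c + d + N + 1) - Y (c + d + N) with hδ
  have hcalA : calA A Ad *ᵥ ofBlocks (zeta N c d Y) = δ := by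
    rw [calA_mulVec, hδ, hY]; rfl
  have hM : ((N + (c + d) : ℕ) : ℝ) - N = (c + d : ℕ) := by push_cast; ring
  have hQ₁ := sum_range_shift_sub (fun v => quad Q₁ (Y v)) (c + d) N
  have hQ₂ := sum_range_shift_sub (fun v => quad Q₂ (Y v)) 0 (c + d)
  have tR₁ := tailSum_shift_sub (N := N) (a := c + d) le_rfl (fun _ => (N : ℝ))
    fun v => quad R₁ (Y (v + 1) - Y v)
  have tR₂ := tailSum_shift_sub (N := c + d) (a := 0) (b := c + d + N) (by omega)
    (fun _ => ((c + d : ℕ) : ℝ)) fun v => quad R₂ (Y (v + 1) - Y v)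
  have tS₁ := tailSum_shift_sub (N := N) (a := c + d) le_rfl (fun i => (N : ℝ) - i)
    fun v => quad S₁ (Y (v + 1) - Y v)
  have tS₂ := tailSum_shift_sub (N := c + d) (a := 0) (b := c + d + N) (by omega)
    (fun i => ((c + d : ℕ) : ℝ) - i) fun v => quad S₂ (Y (v + 1) - Y v)
  rw [← hδ, Finset.sum_const, Finset.card_range, nsmul_eq_mul, ← Finset.mul_sum] at tR₁ tR₂
  rw [← hδ, sum_range_sub_self] at tS₁ tS₂
  -- the inequalities for the window `[k - h₁, k]`
  have iR₁ := wirtinger hN hR₁ fun j => Y (c + d + j)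
  have iS₁ := double_sum hN hS₁ fun j => Y (c + d + j)
  -- the inequalities for the windows `[k - h, k - h₁]` and `[k - h₂, k - h]`
  have iR₂ : quad (Pi₄ R₂ X) (ofBlocks (zeta N c d Y))
      ≤ (c + d : ℕ) * ∑ i ∈ Finset.range (c + d), quad R₂ (Y (i + 1) - Y i) := by
    have h1 := wirtinger_uniform c hR₂ fun j => Y (d + j)
    have h2 := wirtinger_uniform d hR₂ Y
    rw [quad_Pi₄, add_comm c d, Finset.sum_range_add, add_comm (∑ i ∈ Finset.range d, _),
      Nat.add_comm d c, Nat.cast_add]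
    refine coupling_le hC c.cast_nonneg d.cast_nonneg ?_ ?_ ?_ ?_
    · rw [Γ₂_mulVec, quad_Rt₂]
      simpa [zeta, add_comm d c, ← add_assoc] using h1
    · rw [Γ₃_mulVec, quad_Rt₂]
      simpa [zeta] using h2
    · intro h0
      obtain rfl : c = 0 := by exact_mod_cast h0
      refine ⟨?_, by simp⟩
      rw [Γ₂_mulVec, ← ofBlocks_zero]
      congr 1
      ext1 i
      fin_cases i <;> simp [zeta, two_smul]
    · intro h0
      obtain rfl : d = 0 := by exact_mod_cast h0
      refine ⟨?_, by simp⟩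
      rw [Γ₃_mulVec, ← ofBlocks_zero]
      congr 1
      ext1 i
      fin_cases i <;> simp [zeta, two_smul]
  have iS₂ : quad (Pi₆ S₂) (ofBlocks (zeta N c d Y)) ≤ ∑ i ∈ Finset.range (c + d),
      (((c + d : ℕ) : ℝ) - i) * quad S₂ (Y (i + 1) - Y i) := by
    have h1 := double_sum_uniform c hS₂ fun j => Y (d + j)
    have h2 := double_sum_uniform d hS₂ Y
    have h3 : ∑ i ∈ Finset.range d, ((d : ℝ) - i) * quad S₂ (Y (i + 1) - Y i)
        ≤ ∑ i ∈ Finset.range d, (((c + d : ℕ) : ℝ) - i) * quad S₂ (Y (i + 1) - Y i) :=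
      Finset.sum_le_sum fun i _ => mul_le_mul_of_nonneg_right
        (by push_cast; linarith [(c.cast_nonneg : (0 : ℝ) ≤ c)]) (quad_nonneg hS₂ _)
    have h4 : ∑ i ∈ Finset.range c, (((c + d : ℕ) : ℝ) - (d + i : ℕ))
          * quad S₂ (Y (d + i + 1) - Y (d + i))
        = ∑ i ∈ Finset.range c, ((c : ℝ) - i) * quad S₂ (Y (d + (i + 1)) - Y (d + i)) :=
      Finset.sum_congr rfl fun i _ => by push_cast; ring_nf
    have h5 : ∑ i ∈ Finset.range (c + d), (((c + d : ℕ) : ℝ) - i) * quad S₂ (Y (i + 1) - Y i)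
        = ∑ i ∈ Finset.range d, (((c + d : ℕ) : ℝ) - i) * quad S₂ (Y (i + 1) - Y i)
          + ∑ i ∈ Finset.range c, (((c + d : ℕ) : ℝ) - (d + i : ℕ))
          * quad S₂ (Y (d + i + 1) - Y (d + i)) := by
      rw [Nat.add_comm c d, Finset.sum_range_add]
    rw [h5, h4, quad_Pi₆]
    simp only [zeta, cons_val, add_zero] at h1 h2 ⊢
    linarith
  rw [PiMatrix, quad_sub_matrix, quad_add_matrix, quad_add_matrix, quad_add_matrix,
    quad_add_matrix, quad_add_matrix, quad_Pi₀_eq_sub _ _ _ _ _ hP, ← ofBlocks_augState,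
    ← ofBlocks_augState_succ hY, quad_Pi₁, quad_Pi₂, quad_Pi₃, quad_Pi₅, hcalA, hM]
  simp only [lyapunov]
  simp only [zeta, cons_val, add_zero, zero_add] at hQ₁ hQ₂ tR₁ tR₂ tS₁ tS₂ iR₁ iS₁ iR₂ iS₂ ⊢
  simp only [← add_assoc] at *
  linarith

end decrease

/-! ### Uniform definiteness and continuity -/

lemma exists_quad_le_of_isNegDef {ι : Type*} [Fintype ι] {M : Matrix ι ι ℝ} (hM : IsNegDef M) :
    ∃ μ : ℝ, 0 < μ ∧ ∀ v, quad M v ≤ -(μ * ‖v‖ ^ 2) := by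
  rcases (Metric.sphere (0 : ι → ℝ) 1).eq_empty_or_nonempty with hS | hS
  · refine ⟨1, one_pos, fun v => ?_⟩
    -- the unit sphere is empty only in the zero space
    have : v = 0 := by
      by_contra hv
      have : ‖v‖⁻¹ • v ∈ Metric.sphere (0 : ι → ℝ) 1 := by
        simp [norm_smul, inv_mul_cancel₀ (norm_ne_zero_iff.2 hv)]
      rwa [hS] at this
    simp [this]
  · obtain ⟨u, hu, hmax⟩ := (isCompact_sphere (0 : ι → ℝ) 1).exists_isMaxOn hS
      (continuous_quad M).continuousOn
    have hu0 : u ≠ 0 := by rintro rfl; simp at hu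
    refine ⟨-quad M u, neg_pos.2 (hM u hu0), fun v => ?_⟩
    by_cases hv : v = 0
    · simp [hv]
    have hv' : ‖v‖ ≠ 0 := norm_ne_zero_iff.2 hv
    have hmem : ‖v‖⁻¹ • v ∈ Metric.sphere (0 : ι → ℝ) 1 := by
      simp [norm_smul, inv_mul_cancel₀ hv']
    have h1 : quad M (‖v‖⁻¹ • v) ≤ quad M u := hmax hmem
    calc quad M v = ‖v‖ ^ 2 * quad M (‖v‖⁻¹ • v) := by
          rw [quad_smul]; field_simp
      _ ≤ ‖v‖ ^ 2 * quad M u := mul_le_mul_of_nonneg_left h1 (sq_nonneg _)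
      _ = -(-quad M u * ‖v‖ ^ 2) := by ring

lemma exists_le_quad_of_posDef {ι : Type*} [Fintype ι] {M : Matrix ι ι ℝ} (hM : M.PosDef) :
    ∃ μ : ℝ, 0 < μ ∧ ∀ v, μ * ‖v‖ ^ 2 ≤ quad M v := by
  obtain ⟨μ, hμ, h⟩ := exists_quad_le_of_isNegDef (M := -M) fun v hv => by
    simpa [neg_mulVec] using hM.dotProduct_mulVec_pos hv
  refine ⟨μ, hμ, fun v => ?_⟩
  have := h v
  simp only [quad, neg_mulVec, dotProduct_neg] at this ⊢
  linarith

lemma norm_le_norm_ofBlocks {m : ℕ} (z : Fin m → Fin n → ℝ) (i : Fin m) :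
    ‖z i‖ ≤ ‖ofBlocks z‖ :=
  (pi_norm_le_iff_of_nonneg (norm_nonneg _)).2 fun a => norm_le_pi_norm (ofBlocks z) (a, i)

section

variable (P : Matrix (Fin n × Fin 4) (Fin n × Fin 4) ℝ)
  (Q₁ Q₂ R₁ R₂ S₁ S₂ : Matrix (Fin n) (Fin n) ℝ) (N M : ℕ)

lemma continuous_augState : Continuous (augState (n := n) N M) := by
  refine continuous_pi fun i => ?_
  fin_cases i <;> simp only [augState, Fin.reduceFinMk, cons_val] <;> fun_prop

lemma continuous_lyapunov : Continuous (lyapunov P Q₁ Q₂ R₁ R₂ S₁ S₂ N M) := by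
  have h0 := (continuous_quad P).comp (continuous_ofBlocks.comp (continuous_augState (n := n) N M))
  have h1 := continuous_quad Q₁
  have h2 := continuous_quad Q₂
  have h3 := continuous_quad R₁
  have h4 := continuous_quad R₂
  have h5 := continuous_quad S₁
  have h6 := continuous_quad S₂
  simp only [Function.comp_def] at h0
  unfold lyapunov tailSum
  fun_prop

lemma lyapunov_zero : lyapunov P Q₁ Q₂ R₁ R₂ S₁ S₂ N M (0 : ℕ → Fin n → ℝ) = 0 := by
  have : augState (n := n) N M 0 = 0 := by
    ext1 i
    fin_cases i <;> simp [augState]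
  simp [lyapunov, this, ofBlocks_zero, tailSum]

/-- The Lyapunov functional only depends on the entries `0, …, M + N` of the history. -/
lemma lyapunov_congr {Y Z : ℕ → Fin n → ℝ} (h : ∀ j ≤ M + N, Y j = Z j) :
    lyapunov P Q₁ Q₂ R₁ R₂ S₁ S₂ N M Y = lyapunov P Q₁ Q₂ R₁ R₂ S₁ S₂ N M Z := by
  have hN : ∀ j ∈ Finset.range N, Y (M + j) = Z (M + j) := fun j hj =>
    h _ (by have := Finset.mem_range.1 hj; omega)
  have hM : ∀ j ∈ Finset.range M, Y j = Z j := fun j hj =>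
    h _ (by have := Finset.mem_range.1 hj; omega)
  have haug : augState N M Y = augState N M Z := by
    unfold augState
    rw [h _ le_rfl, Finset.sum_congr rfl hN, Finset.sum_congr rfl hM,
      Finset.sum_congr rfl fun (j : ℕ) hj =>
        show ((j : ℝ) + 1) • Y (M + j) = ((j : ℝ) + 1) • Z (M + j) by rw [hN j hj]]
  have htail : ∀ (L a : ℕ) (w : ℕ → ℝ) (R : Matrix (Fin n) (Fin n) ℝ),
      tailSum L a (M + N) w (fun v => quad R (Y (v + 1) - Y v))
        = tailSum L a (M + N) w (fun v => quad R (Z (v + 1) - Z v)) := fun L a w R =>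
    Finset.sum_congr rfl fun i _ => by
      congr 1
      refine Finset.sum_congr rfl fun v hv => ?_
      have := (Finset.mem_Ico.1 hv).2
      simp only
      rw [h v (by omega), h (v + 1) (by omega)]
  unfold lyapunov
  rw [haug, htail, htail, htail, htail, Finset.sum_congr rfl fun j hj => congrArg (quad Q₁) (hN j hj)]
  simp only [zero_add]
  rw [Finset.sum_congr rfl fun j hj => congrArg (quad Q₂) (hM j hj)]

lemma exists_lyapunov_lt {η : ℝ} (hη : 0 < η) : ∃ δ : ℝ, 0 < δ ∧ ∀ Y : ℕ → Fin n → ℝ,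
    (∀ j ≤ M + N, ‖Y j‖ < δ) → lyapunov P Q₁ Q₂ R₁ R₂ S₁ S₂ N M Y < η := by
  let F : (Fin (M + N + 1) → Fin n → ℝ) → ℝ := fun z =>
    lyapunov P Q₁ Q₂ R₁ R₂ S₁ S₂ N M fun j => z ⟨min j (M + N), by omega⟩
  have hF : Continuous F := (continuous_lyapunov P Q₁ Q₂ R₁ R₂ S₁ S₂ N M).comp (by fun_prop)
  have hF0 : F 0 = 0 := lyapunov_zero P Q₁ Q₂ R₁ R₂ S₁ S₂ N M
  obtain ⟨δ, hδ, h⟩ := Metric.continuous_iff.1 hF 0 η hη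
  refine ⟨δ, hδ, fun Y hY => ?_⟩
  have hdist : dist (fun i : Fin (M + N + 1) => Y i) 0 < δ := by
    rw [dist_zero_right, pi_norm_lt_iff hδ]
    exact fun i => hY i (by omega)
  have h1 := h _ hdist
  rw [hF0, Real.dist_eq, sub_zero] at h1
  have h2 : F (fun i => Y i) = lyapunov P Q₁ Q₂ R₁ R₂ S₁ S₂ N M Y :=
    lyapunov_congr _ _ _ _ _ _ _ _ _ fun j hj => by simp [hj]
  rw [← h2]
  exact (le_abs_self _).trans_lt h1

end

/-! ### From the matrix inequalities to asymptotic stability -/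

lemma le_zero_of_succ_add_le {V r : ℕ → ℝ} (hr : ∀ k, 0 ≤ r k) (h : ∀ k, V (k + 1) + r k ≤ V k)
    (k : ℕ) : V k ≤ V 0 :=
  antitone_nat_of_succ_le (fun k => by linarith [h k, hr k]) k.zero_le

lemma tendsto_zero_of_succ_add_le {V r : ℕ → ℝ} (hV : ∀ k, 0 ≤ V k) (hr : ∀ k, 0 ≤ r k)
    (h : ∀ k, V (k + 1) + r k ≤ V k) : Tendsto r atTop (𝓝 0) := by
  have hsum : ∀ k, ∑ i ∈ Finset.range k, r i ≤ V 0 - V k := by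
    intro k
    induction k with
    | zero => simp
    | succ k ih => rw [Finset.sum_range_succ]; linarith [h k]
  exact (summable_of_sum_range_le hr fun k =>
    (hsum k).trans (sub_le_self _ (hV k))).tendsto_atTop_zero

/-- `Π(h)` is uniformly negative definite for `h₁ ≤ h ≤ h₂`, being a convex combination of `Π(h₁)`
and `Π(h₂)`. -/
lemma exists_quad_PiMatrix_le {A Ad : Matrix (Fin n) (Fin n) ℝ}
    {P : Matrix (Fin n × Fin 4) (Fin n × Fin 4) ℝ} {Q₁ Q₂ R₁ R₂ S₁ S₂ : Matrix (Fin n) (Fin n) ℝ}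
    {X : Matrix (Fin n × Fin 3) (Fin n × Fin 3) ℝ} {N M : ℕ}
    (hPi₁ : IsNegDef (PiMatrix A Ad P Q₁ Q₂ R₁ R₂ S₁ S₂ X N (N + M : ℕ) N))
    (hPi₂ : IsNegDef (PiMatrix A Ad P Q₁ Q₂ R₁ R₂ S₁ S₂ X N (N + M : ℕ) (N + M : ℕ))) :
    ∃ μ : ℝ, 0 < μ ∧ ∀ c ≤ M, ∀ z : Fin 10 → Fin n → ℝ,
      quad (PiMatrix A Ad P Q₁ Q₂ R₁ R₂ S₁ S₂ X N (N + M : ℕ) (N + c : ℕ)) (ofBlocks z)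
        ≤ -(μ * ‖z 0‖ ^ 2) := by
  obtain ⟨μ₁, hμ₁, h1⟩ := exists_quad_le_of_isNegDef hPi₁
  obtain ⟨μ₂, hμ₂, h2⟩ := exists_quad_le_of_isNegDef hPi₂
  refine ⟨min μ₁ μ₂, lt_min hμ₁ hμ₂, fun c hc z => ?_⟩
  obtain ⟨b, hb0, hb1, hb⟩ : ∃ b : ℝ, 0 ≤ b ∧ b ≤ 1 ∧ (c : ℝ) = b * M := by
    rcases M.eq_zero_or_pos with rfl | hM
    · exact ⟨0, le_rfl, zero_le_one, by simpa using hc⟩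
    · have hM' : (0 : ℝ) < M := by exact_mod_cast hM
      have hc' : (c : ℝ) ≤ M := by exact_mod_cast hc
      exact ⟨c / M, by positivity, (div_le_one hM').2 hc', by field_simp⟩
  have hh : ((N + c : ℕ) : ℝ) = (1 - b) * N + b * (N + M : ℕ) := by
    push_cast; rw [hb]; ring
  rw [hh, quad_PiMatrix_affine _ _ _ _ _ _ _ _ _ _ _ _ _ _ (by ring)]
  have hz : ‖z 0‖ ^ 2 ≤ ‖ofBlocks z‖ ^ 2 :=
    pow_le_pow_left₀ (norm_nonneg _) (norm_le_norm_ofBlocks z 0) 2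
  have k1 : quad (PiMatrix A Ad P Q₁ Q₂ R₁ R₂ S₁ S₂ X N (N + M : ℕ) N) (ofBlocks z)
      ≤ -(min μ₁ μ₂ * ‖z 0‖ ^ 2) := (h1 _).trans <| neg_le_neg <|
    mul_le_mul (min_le_left _ _) hz (sq_nonneg _) hμ₁.le
  have k2 : quad (PiMatrix A Ad P Q₁ Q₂ R₁ R₂ S₁ S₂ X N (N + M : ℕ) (N + M : ℕ)) (ofBlocks z)
      ≤ -(min μ₁ μ₂ * ‖z 0‖ ^ 2) := (h2 _).trans <| neg_le_neg <|
    mul_le_mul (min_le_right _ _) hz (sq_nonneg _) hμ₂.le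
  have k3 := mul_le_mul_of_nonneg_left k1 (sub_nonneg.2 hb1)
  have k4 := mul_le_mul_of_nonneg_left k2 hb0
  linarith

/-- A solution, shifted by `h₂` so that it is indexed by the natural numbers. -/
def shifted (h₂ : ℕ) (x : ℤ → EuclideanSpace ℝ (Fin n)) (j : ℕ) : Fin n → ℝ :=
  (x ((j : ℤ) - h₂)).ofLp

lemma shifted_step {A Ad : Matrix (Fin n) (Fin n) ℝ} {h₂ : ℕ} {h : ℕ → ℕ}
    {φ x : ℤ → EuclideanSpace ℝ (Fin n)} (hx : IsSolution A Ad h₂ h φ x) {k d : ℕ}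
    (hd : h k + d = h₂) :
    shifted h₂ x (k + h₂ + 1) = A *ᵥ shifted h₂ x (k + h₂) + Ad *ᵥ shifted h₂ x (k + d) := by
  have h1 : ((k + h₂ + 1 : ℕ) : ℤ) - h₂ = k + 1 := by push_cast; ring
  have h2 : ((k + h₂ : ℕ) : ℤ) - h₂ = k := by push_cast; ring
  have h3 : ((k + d : ℕ) : ℤ) - h₂ = k - h k := by rw [← hd]; push_cast; ring
  simp only [shifted, h1, h2, h3, hx.2 k]
  simp

end DelayLMI

end

theorem theorem4p1 (n : ℕ) (A Ad : Matrix (Fin n) (Fin n) ℝ)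
    (h₁ h₂ : ℕ) (one_le_h₁ : 1 ≤ h₁) (h₁_le_h₂ : h₁ ≤ h₂)
    (hLMI : ∃ (P : Matrix (Fin n × Fin 4) (Fin n × Fin 4) ℝ)
        (Q₁ Q₂ R₁ R₂ S₁ S₂ : Matrix (Fin n) (Fin n) ℝ)
        (X : Matrix (Fin n × Fin 3) (Fin n × Fin 3) ℝ),
      P.PosDef ∧ Q₁.PosDef ∧ Q₂.PosDef ∧ R₁.PosDef ∧ R₂.PosDef ∧ S₁.PosDef ∧ S₂.PosDef ∧
      (DelayLMI.couplingMatrix R₂ X).PosSemidef ∧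
      DelayLMI.IsNegDef (DelayLMI.PiMatrix A Ad P Q₁ Q₂ R₁ R₂ S₁ S₂ X h₁ h₂ h₁) ∧
      DelayLMI.IsNegDef (DelayLMI.PiMatrix A Ad P Q₁ Q₂ R₁ R₂ S₁ S₂ X h₁ h₂ h₂)) :
    ∀ h : ℕ → ℕ, (∀ k, h₁ ≤ h k ∧ h k ≤ h₂) →
      DelayLMI.IsAsymptoticallyStable A Ad h₂ h := by
  open DelayLMI in
  obtain ⟨P, Q₁, Q₂, R₁, R₂, S₁, S₂, X, hP, hQ₁, hQ₂, hR₁, hR₂, hS₁, hS₂, hC, hPi₁, hPi₂⟩ := hLMI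
  intro h hh
  obtain ⟨M, rfl⟩ := Nat.exists_eq_add_of_le h₁_le_h₂
  obtain ⟨μ, hμ, hPi⟩ := exists_quad_PiMatrix_le hPi₁ hPi₂
  obtain ⟨ν, hν, hPν⟩ := exists_le_quad_of_posDef hP
  have hPsymm : Pᵀ = P := by
    rw [← conjTranspose_eq_transpose_of_trivial]; exact hP.isHermitian
  -- `V x k` is the Lyapunov functional of the solution `x` at time `k`
  let V : (ℤ → EuclideanSpace ℝ (Fin n)) → ℕ → ℝ := fun x k =>
    lyapunov P Q₁ Q₂ R₁ R₂ S₁ S₂ h₁ M fun j => shifted (h₁ + M) x (k + j)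
  have hshift : ∀ (x : ℤ → EuclideanSpace ℝ (Fin n)) (k : ℕ), shifted (h₁ + M) x (k + (M + h₁)) = (x k).ofLp := by
    intro x k
    have : ((k + (M + h₁) : ℕ) : ℤ) - (h₁ + M : ℕ) = k := by push_cast; ring
    rw [shifted, this]
  have hlower : ∀ (x : ℤ → EuclideanSpace ℝ (Fin n)) (k : ℕ), ν * ‖(x k).ofLp‖ ^ 2 ≤ V x k := by
    intro x k
    refine le_trans ?_ (quad_augState_le_lyapunov hQ₁.posSemidef hQ₂.posSemidef hR₁.posSemidef
      hR₂.posSemidef hS₁.posSemidef hS₂.posSemidef h₁ M _)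
    refine le_trans ?_ (hPν _)
    have := norm_le_norm_ofBlocks (augState h₁ M fun j => shifted (h₁ + M) x (k + j)) 0
    rw [show augState h₁ M (fun j => shifted (h₁ + M) x (k + j)) 0 = (x k).ofLp from
      hshift x k] at this
    gcongr
  have hstep : ∀ φ x, IsSolution A Ad (h₁ + M) h φ x →
      ∀ k : ℕ, V x (k + 1) + μ * ‖(x k).ofLp‖ ^ 2 ≤ V x k := by
    intro φ x hx k
    obtain ⟨c, hc⟩ := Nat.exists_eq_add_of_le (hh k).1
    obtain ⟨d, hd⟩ := Nat.exists_eq_add_of_le (hh k).2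
    obtain rfl : M = c + d := by omega
    have hnew := shifted_step hx hd.symm
    rw [show k + (h₁ + (c + d)) + 1 = k + (c + d + h₁ + 1) by omega,
      show k + (h₁ + (c + d)) = k + (c + d + h₁) by omega] at hnew
    have key := lyapunov_succ_sub_le (A := A) (Ad := Ad) (Q₁ := Q₁) (Q₂ := Q₂) (N := h₁) (c := c)
      (d := d) (Y := fun j => shifted (h₁ + (c + d)) x (k + j)) one_le_h₁ hPsymm
      hR₁.posSemidef hR₂.posSemidef hS₁.posSemidef hS₂.posSemidef hC
      hnew
    have hz := hPi c (Nat.le_add_right c d)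
      (zeta h₁ c d fun j => shifted (h₁ + (c + d)) x (k + j))
    rw [show zeta h₁ c d (fun j => shifted (h₁ + (c + d)) x (k + j)) 0 = (x k).ofLp from
      hshift x k] at hz
    have hnext : V x (k + 1) = lyapunov P Q₁ Q₂ R₁ R₂ S₁ S₂ h₁ (c + d)
        fun j => shifted (h₁ + (c + d)) x (k + (j + 1)) := by
      simp only [V, add_assoc, add_comm 1]
    rw [hnext]
    simp only [V]
    linarith
  have hμr : ∀ (x : ℤ → EuclideanSpace ℝ (Fin n)) (k : ℕ), 0 ≤ μ * ‖(x k).ofLp‖ ^ 2 :=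
    fun x k => by positivity
  refine ⟨fun ε hε => ?_, fun φ x hx => ?_⟩
  · -- a sup-norm ball contained in the Euclidean ball of radius `ε`
    obtain ⟨η, hη, hball⟩ := Metric.continuous_iff.1
      (PiLp.continuous_toLp 2 fun _ : Fin n => ℝ) 0 ε hε
    obtain ⟨δ, hδ, hV⟩ := exists_lyapunov_lt P Q₁ Q₂ R₁ R₂ S₁ S₂ h₁ M
      (show 0 < ν * η ^ 2 by positivity)
    refine ⟨δ, hδ, fun φ x hx hφ k => ?_⟩
    have h0 : V x 0 < ν * η ^ 2 := by
      refine hV _ fun j hj => ?_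
      have h1 : -((h₁ + M : ℕ) : ℤ) ≤ ((0 + j : ℕ) : ℤ) - (h₁ + M : ℕ) := by omega
      have h2 : ((0 + j : ℕ) : ℤ) - (h₁ + M : ℕ) ≤ 0 := by omega
      refine lt_of_le_of_lt ?_ (hφ _ h1 h2)
      rw [shifted, hx.1 _ h1 h2]
      exact (pi_norm_le_iff_of_nonneg (norm_nonneg _)).2 fun a => PiLp.norm_apply_le _ a
    have h1 : ν * ‖(x k).ofLp‖ ^ 2 < ν * η ^ 2 := (hlower x k).trans_lt <|
      (le_zero_of_succ_add_le (hμr x) (hstep φ x hx) k).trans_lt h0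
    have h2 : ‖(x k).ofLp‖ < η :=
      lt_of_pow_lt_pow_left₀ 2 hη.le (lt_of_mul_lt_mul_left h1 hν.le)
    simpa using hball (x k).ofLp (by simpa using h2)
  · have h1 := tendsto_zero_of_succ_add_le
      (fun k => le_trans (by positivity) (hlower x k)) (hμr x) (hstep φ x hx)
    have h2 : Tendsto (fun k : ℕ => ‖(x k).ofLp‖) atTop (𝓝 0) := by
      have := (h1.const_mul μ⁻¹).sqrt
      simpa [← mul_assoc, inv_mul_cancel₀ hμ.ne', Real.sqrt_sq] using this
    have h3 := ((PiLp.continuous_toLp 2 fun _ : Fin n => ℝ).tendsto 0).comp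
      (tendsto_zero_iff_norm_tendsto_zero.2 h2)
    simpa [Function.comp_def] using h3
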